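/- Let $m_1,m_2\ge 1$ be integers and $l=m_1+m_2$. Let $e_{i,j}$ denote the $l\times l$ matrix units, and put $$W(z,s)=\left(z-\tfrac12\right)e_{1,m_1}-s\,e_{1,l}+s\sum_{i=2}^{l}e_{i,i-1}.$$ Put $q_a=\frac{a}{m_1}$ and $K_a=\sum_{j=1}^{a}e_{j,\,m_1-a+j}$ for $1\le a\le m_1$, and $q_a=\frac{l-a}{m_2}$ and $K_a=-\sum_{j=1}^{l-a}e_{a+j,\,m_1+j}$ for $m_1<a\le l-1$. Consider the topological difference equation $$M(z-1,s)\,W(z,s)=W(z,s)\,M(z,s),$$ where $z\mapsto z-1$ acts on formal series through $(z-1)^r=\sum_{k\ge0}(-1)^k\binom rk z^{r-k}$ for $r\in\mathbb Q$. For each $a=1,\dots,l-1$ there is a unique formal solution $M_a(z,s)\in z^{1-q_a}\,\mathrm{Mat}\bigl(l\times l,\mathbb C(s)((z^{-1}))\bigr)$ of this equation such that $M_a(z,s)=z^{1-q_a}\bigl(K_a+O(z^{-1})\bigr)$. These unique solutions have the following properties. 1. $\mathrm{Tr}\,M_a(z,s)=m_1\delta_{a,m_1}$ and $\det M_a(z,s)=0$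 for $a=1,\dots,l-1$. 2. $M_a(z,s)=s^{1-a}M_1(z,s)^{a}$ for $a=1,\dots,m_1$, and $M_a(z,s)=(-s)^{1-l+a}M_{l-1}(z,s)^{l-a}$ for $a=m_1+1,\dots,l-1$. 3. $M_a(z,s)M_b(z,s)=M_b(z,s)M_a(z,s)=0$ for $1\le a\le m_1<b\le l-1$. -/

import Mathlib

noncomputable section

/-- The field `ℂ(s)` of rational functions in the parameter `s`. -/
abbrev CoeffField : Type := RatFunc ℂ

/-- The parameter `s`. -/
def sVar : CoeffField := RatFunc.X

/-- Formal series in rational powers of `z` with coefficients in `ℂ(s)`, as Hahn series in `z⁻¹`: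
the coefficient at the exponent `e : ℚ` is the coefficient of `z ^ (-e)`.
This field contains `z ^ r · ℂ(s)((z⁻¹))` for every rational `r`. -/
abbrev ZSeries : Type := HahnSeries ℚ CoeffField

/-- The monomial `z ^ r`, `r : ℚ`. -/
def zPow (r : ℚ) : ZSeries := HahnSeries.single (-r) 1

/-- The inclusion `ℂ(s) → ZSeries` of the constants (in `z`). -/
def constSeries : CoeffField →+* ZSeries := HahnSeries.C

/-- The inclusion `ℂ(s)((z⁻¹)) → ZSeries`. The Laurent series variable is `z⁻¹`. -/
def ofLaurent : LaurentSeries CoeffField →+* ZSeries :=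
  HahnSeries.embDomainRingHom (Int.castAddHom ℚ) Int.cast_injective (fun _ _ => Int.cast_le)

theorem zShift_support_isPWO (f : ZSeries) :
    (Function.support fun e : ℚ => ∑ᶠ k : ℕ,
      (-1 : CoeffField) ^ k * algebraMap ℚ CoeffField (Ring.choose ((k : ℚ) - e) k) *
        f.coeff (e - k)).IsPWO := by
  have hN : (Set.range ((↑) : ℕ → ℚ)).IsPWO := by
    rw [← Set.image_univ]
    exact (Set.isPWO_of_wellQuasiOrderedLE Set.univ).image_of_monotone Nat.mono_cast
  refine (f.isPWO_support.add hN).mono ?_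
  intro e he
  by_contra hne
  refine he (finsum_eq_zero_of_forall_eq_zero fun k => ?_)
  have : f.coeff (e - k) = 0 := by
    by_contra hk
    exact hne (Set.mem_add.2 ⟨e - k, hk, k, ⟨k, rfl⟩, by ring⟩)
  rw [this, mul_zero]

/-- The substitution `z ↦ z - 1`, obtained by expanding
`(z - 1) ^ r = ∑_{k ≥ 0} (-1) ^ k * binom(r, k) * z ^ (r - k)` in each term `c * z ^ r`.
The coefficient of `z ^ (-e)` in `f(z - 1)` collects the terms `r = k - e`; only finitely many
`k` contribute because the exponents of `f` form a well-ordered set. -/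
def zShift (f : ZSeries) : ZSeries where
  coeff e := ∑ᶠ k : ℕ,
    (-1 : CoeffField) ^ k * algebraMap ℚ CoeffField (Ring.choose ((k : ℚ) - e) k) *
      f.coeff (e - k)
  isPWO_support' := zShift_support_isPWO f

/-- The matrix unit `e_{i,j}` of size `l × l`, with the usual indices `i, j = 1, …, l`
(position `p : Fin l` is the row or column number `p + 1`). -/
def matUnit (R : Type) [Zero R] [One R] (l i j : ℕ) : Matrix (Fin l) (Fin l) R :=
  Matrix.of fun p q => if (p : ℕ) + 1 = i ∧ (q : ℕ) + 1 = j then 1 else 0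

/-- `W(z,s) = (z - 1/2) e_{1,m₁} - s e_{1,l} + s ∑_{i=2}^l e_{i,i-1}`, `l = m₁ + m₂`. -/
def matW (m₁ m₂ : ℕ) : Matrix (Fin (m₁ + m₂)) (Fin (m₁ + m₂)) ZSeries :=
  (zPow 1 - constSeries (1 / 2 : CoeffField)) • matUnit ZSeries (m₁ + m₂) 1 m₁
    - constSeries sVar • matUnit ZSeries (m₁ + m₂) 1 (m₁ + m₂)
    + constSeries sVar •
      ∑ i ∈ Finset.Icc 2 (m₁ + m₂), matUnit ZSeries (m₁ + m₂) i (i - 1)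

/-- The topological difference equation `M(z-1,s) W(z,s) = W(z,s) M(z,s)`. -/
def SatisfiesTDE (m₁ m₂ : ℕ) (M : Matrix (Fin (m₁ + m₂)) (Fin (m₁ + m₂)) ZSeries) : Prop :=
  M.map zShift * matW m₁ m₂ = matW m₁ m₂ * M

/-- `q_a = a / m₁` for `a ≤ m₁` and `q_a = (l - a) / m₂` for `m₁ < a < l`. -/
def qDeg (m₁ m₂ a : ℕ) : ℚ :=
  if a ≤ m₁ then (a : ℚ) / m₁ else ((m₁ : ℚ) + m₂ - a) / m₂

/-- `K_a = ∑_{j=1}^a e_{j,m₁-a+j}` for `a ≤ m₁` and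
`K_a = -∑_{j=1}^{l-a} e_{a+j,m₁+j}` for `m₁ < a < l`. -/
def matK (m₁ m₂ a : ℕ) : Matrix (Fin (m₁ + m₂)) (Fin (m₁ + m₂)) CoeffField :=
  if a ≤ m₁ then
    ∑ j ∈ Finset.Icc 1 a, matUnit CoeffField (m₁ + m₂) j (m₁ - a + j)
  else
    -∑ j ∈ Finset.Icc 1 (m₁ + m₂ - a), matUnit CoeffField (m₁ + m₂) (a + j) (m₁ + j)

/-- `M` lies in `z ^ (1 - q_a) Mat(l × l, ℂ(s)((z⁻¹)))` and
`M = z ^ (1 - q_a) (K_a + O(z⁻¹))`. -/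
def HasLeadingForm (m₁ m₂ a : ℕ) (M : Matrix (Fin (m₁ + m₂)) (Fin (m₁ + m₂)) ZSeries) : Prop :=
  ∃ N : Matrix (Fin (m₁ + m₂)) (Fin (m₁ + m₂)) (LaurentSeries CoeffField),
    M = zPow (1 - qDeg m₁ m₂ a) • N.map ofLaurent ∧
    ∀ i j, ∀ n : ℤ, n < 1 → (N i j - HahnSeries.C (matK m₁ m₂ a i j)).coeff n = 0

/-- The formal solutions `M_a` of the topological difference equation. -/
def IsTDESolution (m₁ m₂ a : ℕ) (M : Matrix (Fin (m₁ + m₂)) (Fin (m₁ + m₂)) ZSeries) : Prop :=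
  SatisfiesTDE m₁ m₂ M ∧ HasLeadingForm m₁ m₂ a M

end

/-! Over an algebraic closure F of ℂ(s), the equation is diagonalised by formal wave functions:
column vectors v with W(z) v(z) = s ξ(z) v(z-1). The rows of W below the first force the components
of v to be products ξ(z) ξ(z-1) ⋯ of shifts of one scalar series, and the first row becomes a scalar
difference equation for ξ. That equation has m₁ solutions ξ ~ c z^(1/m₁) with c^m₁ = 1/s, where one
product dominates, and m₂ solutions ξ ~ c⁻¹ z^(-1/m₂) with c^m₂ = 1/s, where the other does
(`exists_multiplier`). Dual row vectors u with u(z-1) W(z) = s η(z) u(z) are built in the same way.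

If M solves the equation, then g = u M v satisfies g(z-1) ξ = η g (`shift_dotProduct_mulVec`). When
ξ and η have different leading terms, g = 0. When u and v belong together, dividing by the same
relation for M = 1 shows that g / (u v) is invariant under the shift, hence constant. So solutions
over F are exactly the matrices acting on the l wave functions by constants
(`IsWaveBasis.exists_diagonal`, `isEquivariant_spectral`), and they form a commutative algebra
isomorphic to F^l. A solution whose entries all decay is zero, because its eigenvalues must vanish
(`eq_zero_of_isBigO`); hence the coefficients of nonnegative powers of z determine a solution.

The solution M_a has eigenvalues s c^a on the first family and 0 on the second if a ≤ m₁; otherwise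
it has 0 on the first and -s c^(l-a) on the second. Sums over roots of unity identify its leading
term (`coeff_spectral`). The trace, the determinant, the power formulas and the vanishing products
are then statements about eigenvalues.

To get back to ℂ(s), a linear retraction F → ℂ(s) is applied to the coefficients and only exponents
in one class modulo ℤ are kept. Both operations preserve the equation, since W has coefficients in
ℂ(s) and integral exponents (`exists_isTDESolution`). Uniqueness and all identities descend because
extension of coefficients is injective. -/

open HahnSeries

/-! ### Orders of magnitude -/

section BigO

variable {F : Type} [Field F]

/-- `f = O(z ^ (-d))`. -/
def IsBigO (d : ℚ) (f : HahnSeries ℚ F) : Prop := ∀ e < d, f.coeff e = 0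

namespace IsBigO

variable {d d' : ℚ} {f g : HahnSeries ℚ F}

theorem mono (h : IsBigO d f) (hd : d' ≤ d) : IsBigO d' f :=
  fun e he => h e (he.trans_le hd)

theorem iff_le_orderTop : IsBigO d f ↔ (d : WithTop ℚ) ≤ f.orderTop := by
  rw [le_orderTop_iff_forall]
  exact ⟨fun h e he => h e (WithTop.coe_lt_coe.1 he), fun h e he => h e (WithTop.coe_lt_coe.2 he)⟩

theorem zero : IsBigO d (0 : HahnSeries ℚ F) := fun _ _ => rfl

theorem add (hf : IsBigO d f) (hg : IsBigO d g) : IsBigO d (f + g) := fun e he => by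
  rw [coeff_add, hf e he, hg e he, add_zero]

theorem neg (hf : IsBigO d f) : IsBigO d (-f) := fun e he => by
  rw [coeff_neg, hf e he, neg_zero]

theorem sub (hf : IsBigO d f) (hg : IsBigO d g) : IsBigO d (f - g) := by
  rw [sub_eq_add_neg]
  exact hf.add hg.neg

theorem mul (hf : IsBigO d f) (hg : IsBigO d' g) : IsBigO (d + d') (f * g) := by
  rw [iff_le_orderTop] at *
  rw [orderTop_mul, WithTop.coe_add]
  exact add_le_add hf hg

theorem single (d : ℚ) (c : F) : IsBigO d (HahnSeries.single d c) := fun _ he =>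
  coeff_single_of_ne he.ne

theorem C (c : F) : IsBigO 0 (HahnSeries.C c) := single 0 c

theorem one : IsBigO 0 (1 : HahnSeries ℚ F) := single 0 1

theorem sum {ι : Type*} {s : Finset ι} {u : ι → HahnSeries ℚ F} (h : ∀ i ∈ s, IsBigO d (u i)) :
    IsBigO d (∑ i ∈ s, u i) := fun e he => by
  rw [coeff_sum]
  exact Finset.sum_eq_zero fun i hi => h i hi e he

theorem eq_zero (h : ∀ n : ℕ, IsBigO (n : ℚ) f) : f = 0 := by
  ext e
  obtain ⟨n, hn⟩ := exists_nat_gt e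
  exact h n e hn

theorem order (f : HahnSeries ℚ F) : IsBigO f.order f := fun _ he => coeff_eq_zero_of_lt_order he

end IsBigO

/-- `f = z ^ r (c + O(z⁻¹))`. -/
def IsLead (r : ℚ) (c : F) (f : HahnSeries ℚ F) : Prop := IsBigO (1 - r) (f - single (-r) c)

namespace IsLead

variable {r r' : ℚ} {c c' : F} {f g : HahnSeries ℚ F}

theorem single (r : ℚ) (c : F) : IsLead r c (HahnSeries.single (-r) c) := by
  rw [IsLead, sub_self]
  exact IsBigO.zero

theorem one : IsLead 0 1 (1 : HahnSeries ℚ F) := by simpa using single (F := F) 0 1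

theorem isBigO (h : IsLead r c f) : IsBigO (-r) f := by
  have := (IsBigO.mono h (by linarith : -r ≤ 1 - r)).add (IsBigO.single (-r) c)
  rwa [sub_add_cancel] at this

theorem of_isBigO (h : IsBigO (1 - r) f) : IsLead r (0 : F) f := by
  rwa [IsLead, single_eq_zero, sub_zero]

theorem mul (hf : IsLead r c f) (hg : IsLead r' c' g) : IsLead (r + r') (c * c') (f * g) := by
  have h1 := IsBigO.mul hf hg.isBigO
  have h2 := IsBigO.mul (IsBigO.single (-r) c) hg
  have h3 := (h1.mono (by linarith : 1 - (r + r') ≤ _)).add (h2.mono (by linarith))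
  rw [IsLead]
  convert h3 using 1
  have : HahnSeries.single (-(r + r')) (c * c') =
      HahnSeries.single (-r) c * HahnSeries.single (-r') c' := by
    rw [single_mul_single, neg_add]
  rw [this]
  ring

theorem prod {ι : Type*} {s : Finset ι} {u : ι → HahnSeries ℚ F} (h : ∀ i ∈ s, IsLead r c (u i)) :
    IsLead (s.card * r) (c ^ s.card) (∏ i ∈ s, u i) := by
  classical
  induction s using Finset.induction_on with
  | empty => simpa using one
  | insert a s ha ih =>
    rw [Finset.prod_insert ha, Finset.card_insert_of_notMem ha]
    have := (h a (Finset.mem_insert_self a s)).mul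
      (ih fun i hi => h i (Finset.mem_insert_of_mem hi))
    convert this using 1
    · push_cast
      ring
    · rw [_root_.pow_succ']

theorem add (hf : IsLead r c f) (hg : IsLead r c' g) : IsLead r (c + c') (f + g) := by
  rw [IsLead]
  convert IsBigO.add hf hg using 1
  rw [single_add]
  ring

theorem neg (hf : IsLead r c f) : IsLead r (-c) (-f) := by
  rw [IsLead]
  convert IsBigO.neg hf using 1
  rw [single_neg]
  ring

theorem add_of_le (hf : IsLead r c f) (hg : IsLead r' c' g) (h : r' + 1 ≤ r) :
    IsLead r c (f + g) := by
  simpa using hf.add (of_isBigO (hg.isBigO.mono (by linarith)))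

theorem sum {ι : Type*} {s : Finset ι} {u : ι → HahnSeries ℚ F} {c : ι → F}
    (h : ∀ i ∈ s, IsLead r (c i) (u i)) : IsLead r (∑ i ∈ s, c i) (∑ i ∈ s, u i) := by
  classical
  induction s using Finset.induction_on with
  | empty => simpa using of_isBigO IsBigO.zero
  | insert a s ha ih =>
    rw [Finset.sum_insert ha, Finset.sum_insert ha]
    exact (h a (Finset.mem_insert_self a s)).add (ih fun i hi => h i (Finset.mem_insert_of_mem hi))

theorem coeff_of_lt (hf : IsLead r c f) {e : ℚ} (he : e < 1 - r) :
    f.coeff e = if e = -r then c else 0 := by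
  have := hf e he
  rw [coeff_sub, sub_eq_zero, coeff_single] at this
  convert this

theorem ne_zero (hf : IsLead r c f) (hc : c ≠ 0) : f ≠ 0 := by
  rintro rfl
  have := hf.coeff_of_lt (e := -r) (by linarith)
  rw [if_pos rfl] at this
  exact hc this.symm

theorem orderTop_eq (hf : IsLead r c f) (hc : c ≠ 0) : f.orderTop = (-r : ℚ) := by
  refine le_antisymm (orderTop_le_of_coeff_ne_zero ?_) (IsBigO.iff_le_orderTop.1 hf.isBigO)
  rwa [hf.coeff_of_lt (by linarith), if_pos rfl]

theorem order_eq (hf : IsLead r c f) (hc : c ≠ 0) : f.order = -r := by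
  have := order_eq_orderTop_of_ne_zero (hf.ne_zero hc)
  rw [hf.orderTop_eq hc] at this
  exact_mod_cast this

theorem leadingCoeff_eq (hf : IsLead r c f) (hc : c ≠ 0) : f.leadingCoeff = c := by
  rw [HahnSeries.leadingCoeff_eq, hf.order_eq hc, hf.coeff_of_lt (by linarith), if_pos rfl]

/-- The error is f⁻¹ · c⁻¹ z^(-r) · (c z^r - f), so the order of f⁻¹ suffices to bound it. -/
theorem inv (hf : IsLead r c f) (hc : c ≠ 0) : IsLead (-r) c⁻¹ f⁻¹ := by
  have hne := hf.ne_zero hc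
  have hi : IsBigO r f⁻¹ := by
    have h1 : f * f⁻¹ = 1 := mul_inv_cancel₀ hne
    have h2 := order_mul hne (inv_ne_zero hne)
    rw [h1, order_one, hf.order_eq hc] at h2
    exact (IsBigO.order f⁻¹).mono (by linarith)
  have h1 := (hi.mul (IsBigO.single r c⁻¹)).mul (IsBigO.neg hf)
  rw [IsLead]
  convert h1 using 1
  · ring
  · have h2 : HahnSeries.single r c⁻¹ * HahnSeries.single (-r) c = 1 := by
      rw [single_mul_single, inv_mul_cancel₀ hc, add_neg_cancel]
      rfl
    have h3 : f⁻¹ * f = 1 := inv_mul_cancel₀ hne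
    rw [neg_neg]
    linear_combination (-f⁻¹) * h2 + HahnSeries.single r c⁻¹ * h3

theorem C_mul (hf : IsLead r c f) (a : F) : IsLead r (a * c) (C a * f) := by
  have := (single (F := F) 0 a).mul hf
  rwa [neg_zero, zero_add] at this

end IsLead

end BigO

/-! ### The substitution `z ↦ z - 1` as a ring homomorphism -/

noncomputable section Shift

variable {F : Type} [Field F] [CharZero F]

/-- The coefficient of `z ^ (r - k)` in the expansion of `(z - 1) ^ r`. -/
def shiftCoeff (F : Type) [Field F] [CharZero F] (k : ℕ) (r : ℚ) : F :=
  (-1) ^ k * ((Ring.choose r k : ℚ) : F)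

theorem shiftCoeff_zero (r : ℚ) : shiftCoeff F 0 r = 1 := by
  simp [shiftCoeff]

theorem shiftCoeff_one (r : ℚ) : shiftCoeff F 1 r = -(r : F) := by
  simp [shiftCoeff]

theorem shiftCoeff_nat_of_lt {n k : ℕ} (h : n < k) : shiftCoeff F k (n : ℚ) = 0 := by
  simp [shiftCoeff, Ring.choose_natCast, Nat.choose_eq_zero_of_lt h]

/-- Vandermonde's identity; it is what makes z ↦ z - 1 multiplicative on fractional powers. -/
theorem shiftCoeff_add (k : ℕ) (r s : ℚ) :
    shiftCoeff F k (r + s) =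
      ∑ p ∈ Finset.HasAntidiagonal.antidiagonal k, shiftCoeff F p.1 r * shiftCoeff F p.2 s := by
  rw [shiftCoeff, Ring.add_choose_eq k (Commute.all r s)]
  push_cast
  rw [Finset.mul_sum]
  refine Finset.sum_congr rfl fun p hp => ?_
  rw [← Finset.HasAntidiagonal.mem_antidiagonal.1 hp, shiftCoeff, shiftCoeff, _root_.pow_add]
  ring

/-- Each term `c z ^ r` of `f` is multiplied by `shiftCoeff k r`. -/
def scaleTerms (k : ℕ) (f : HahnSeries ℚ F) : HahnSeries ℚ F where
  coeff x := shiftCoeff F k (-x) * f.coeff x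
  isPWO_support' := f.isPWO_support.mono fun x hx h => hx (by simp [h])

theorem coeff_scaleTerms (k : ℕ) (f : HahnSeries ℚ F) (x : ℚ) :
    (scaleTerms k f).coeff x = shiftCoeff F k (-x) * f.coeff x := rfl

theorem support_scaleTerms (k : ℕ) (f : HahnSeries ℚ F) :
    (scaleTerms k f).support ⊆ f.support := fun x hx h => hx (by simp [coeff_scaleTerms, h])

theorem scaleTerms_mul (k : ℕ) (f g : HahnSeries ℚ F) :
    scaleTerms k (f * g) =
      ∑ p ∈ Finset.HasAntidiagonal.antidiagonal k, scaleTerms p.1 f * scaleTerms p.2 g := by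
  ext x
  rw [coeff_scaleTerms, coeff_sum, coeff_mul, Finset.mul_sum]
  have h : ∀ p ∈ Finset.HasAntidiagonal.antidiagonal k, (scaleTerms p.1 f * scaleTerms p.2 g).coeff x =
      ∑ ij ∈ Finset.antidiagonal f.isPWO_support g.isPWO_support x,
        (scaleTerms p.1 f).coeff ij.1 * (scaleTerms p.2 g).coeff ij.2 := by
    intro p _
    rw [coeff_mul_left' f.isPWO_support (support_scaleTerms p.1 f)]
    refine Finset.sum_subset (fun ij hij => ?_) fun ij hij hn => ?_
    · rw [Finset.mem_antidiagonal] at hij ⊢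
      exact ⟨hij.1, support_scaleTerms _ _ hij.2.1, hij.2.2⟩
    · rw [Finset.mem_antidiagonal] at hij hn
      have : (scaleTerms p.2 g).coeff ij.2 = 0 := by
        by_contra h0
        exact hn ⟨hij.1, h0, hij.2.2⟩
      rw [this, mul_zero]
  rw [Finset.sum_congr rfl h, Finset.sum_comm]
  refine Finset.sum_congr rfl fun ij hij => ?_
  rw [Finset.mem_antidiagonal] at hij
  rw [← hij.2.2, neg_add, shiftCoeff_add, Finset.sum_mul]
  refine Finset.sum_congr rfl fun p _ => ?_
  rw [coeff_scaleTerms, coeff_scaleTerms]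
  ring

/-- The family of the contributions to `f (z - 1)` of a given drop of the exponent. -/
def shiftFamily (f : HahnSeries ℚ F) : SummableFamily ℚ F ℕ where
  toFun k := single (k : ℚ) 1 * scaleTerms k f
  isPWO_iUnion_support' := by
    have hN : (Set.range ((↑) : ℕ → ℚ)).IsPWO := by
      rw [← Set.image_univ]
      exact (Set.isPWO_of_wellQuasiOrderedLE Set.univ).image_of_monotone Nat.mono_cast
    refine (f.isPWO_support.add hN).mono (Set.iUnion_subset fun k e he => ?_)
    rw [mem_support, coeff_single_mul, one_mul] at he
    exact Set.mem_add.2 ⟨e - k, support_scaleTerms k f he, k, ⟨k, rfl⟩, by ring⟩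
  finite_co_support' e := by
    by_cases hf : f = 0
    · subst hf
      refine Set.finite_empty.subset fun k hk => hk ?_
      simp [coeff_single_mul, coeff_scaleTerms]
    · obtain ⟨N, hN⟩ := exists_nat_gt (e - f.order)
      refine (Set.finite_lt_nat N).subset fun k hk => ?_
      by_contra hlt
      refine hk ?_
      have hk' : (N : ℚ) ≤ k := by exact_mod_cast not_lt.1 hlt
      have : f.coeff (e - k) = 0 := coeff_eq_zero_of_lt_order (by linarith)
      simp [coeff_single_mul, coeff_scaleTerms, this]

theorem shiftFamily_apply (f : HahnSeries ℚ F) (k : ℕ) :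
    shiftFamily f k = single (k : ℚ) 1 * scaleTerms k f := rfl

theorem coeff_shiftFamily (f : HahnSeries ℚ F) (k : ℕ) (e : ℚ) :
    (shiftFamily f k).coeff e = shiftCoeff F k (k - e) * f.coeff (e - k) := by
  rw [shiftFamily_apply, coeff_single_mul, one_mul, coeff_scaleTerms, neg_sub]

theorem coeff_hsum_shiftFamily (f : HahnSeries ℚ F) (e : ℚ) :
    (shiftFamily f).hsum.coeff e = ∑ᶠ k : ℕ, shiftCoeff F k (k - e) * f.coeff (e - k) := by
  rw [SummableFamily.coeff_hsum]
  exact finsum_congr fun k => coeff_shiftFamily f k e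

theorem hsum_shiftFamily_C (a : F) : (shiftFamily (C a)).hsum = C a := by
  ext e
  rw [coeff_hsum_shiftFamily, finsum_eq_single _ 0]
  · simp [shiftCoeff_zero]
  · intro k hk
    by_cases he : e = k
    · subst he
      have := shiftCoeff_nat_of_lt (F := F) (Nat.pos_of_ne_zero hk)
      rw [sub_self]
      simp only [Nat.cast_zero] at this
      rw [this, zero_mul]
    · rw [C_apply, coeff_single_of_ne (sub_ne_zero.2 he), mul_zero]

theorem finsum_antidiagonal {R : Type*} [AddCommMonoid R] (u : ℕ × ℕ → R)
    (hu : (Function.support u).Finite) :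
    ∑ᶠ p, u p = ∑ᶠ k, ∑ p ∈ Finset.HasAntidiagonal.antidiagonal k, u p := by
  classical
  obtain ⟨N, hN⟩ : ∃ N, ∀ p, u p ≠ 0 → p.1 + p.2 < N := by
    refine ⟨(hu.toFinset.sup fun p => p.1 + p.2) + 1, fun p hp => ?_⟩
    exact Nat.lt_succ_of_le (Finset.le_sup (f := fun p : ℕ × ℕ => p.1 + p.2)
      (hu.mem_toFinset.2 hp))
  rw [finsum_eq_sum_of_support_subset (s := Finset.range N), Finset.sum_sigma',
    finsum_eq_sum_of_support_subset (s := (Finset.range N).biUnion Finset.HasAntidiagonal.antidiagonal)]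
  · rw [Finset.sum_biUnion, Finset.sum_sigma']
    intro a _ b _ hab
    refine Finset.disjoint_left.2 fun p hp hq => hab ?_
    rw [← Finset.HasAntidiagonal.mem_antidiagonal.1 hp, ← Finset.HasAntidiagonal.mem_antidiagonal.1 hq]
  · intro p hp
    simpa using hN p hp
  · intro k hk
    obtain ⟨p, hp, h⟩ := Finset.exists_ne_zero_of_sum_ne_zero hk
    simpa [← Finset.HasAntidiagonal.mem_antidiagonal.1 hp] using hN p h

/-- The double sum on the right is regrouped by the total drop of the exponent; each group is then
`scaleTerms_mul`. -/
theorem hsum_shiftFamily_mul (f g : HahnSeries ℚ F) :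
    (shiftFamily (f * g)).hsum = (shiftFamily f).hsum * (shiftFamily g).hsum := by
  rw [← SummableFamily.hsum_mul]
  ext e
  rw [SummableFamily.coeff_hsum, SummableFamily.coeff_hsum, finsum_antidiagonal]
  · refine finsum_congr fun k => ?_
    rw [shiftFamily_apply, scaleTerms_mul, Finset.mul_sum, coeff_sum]
    refine Finset.sum_congr rfl fun p hp => ?_
    have : (single (k : ℚ) (1 : F)) = single (p.1 : ℚ) 1 * single (p.2 : ℚ) 1 := by
      rw [single_mul_single, ← Finset.HasAntidiagonal.mem_antidiagonal.1 hp, mul_one]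
      push_cast
      rfl
    rw [SummableFamily.mul_toFun, shiftFamily_apply, shiftFamily_apply, this]
    congr 1
    ring
  · exact ((shiftFamily f).mul (shiftFamily g)).finite_co_support e

/-- The substitution `z ↦ z - 1`. -/
def shift (F : Type) [Field F] [CharZero F] : HahnSeries ℚ F →+* HahnSeries ℚ F where
  toFun f := (shiftFamily f).hsum
  map_one' := by simpa using hsum_shiftFamily_C (1 : F)
  map_mul' := hsum_shiftFamily_mul
  map_zero' := by simpa using hsum_shiftFamily_C (0 : F)
  map_add' f g := by
    rw [← SummableFamily.hsum_add]
    congr 1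
    ext k e
    rw [SummableFamily.add_apply, coeff_add, coeff_shiftFamily, coeff_shiftFamily,
      coeff_shiftFamily, coeff_add, mul_add]

theorem coeff_shift (f : HahnSeries ℚ F) (e : ℚ) :
    (shift F f).coeff e = ∑ᶠ k : ℕ, shiftCoeff F k (k - e) * f.coeff (e - k) :=
  coeff_hsum_shiftFamily f e

theorem shift_C (a : F) : shift F (C a) = C a := hsum_shiftFamily_C a

/-- The term k = 0 of the expansion reproduces f, and every other term lowers the power of z by at
least one. All later estimates treat the shift as the identity up to this gain. -/
theorem shift_sub_self {d : ℚ} {f : HahnSeries ℚ F} (h : IsBigO d f) :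
    IsBigO (d + 1) (shift F f - f) := by
  intro e he
  rw [coeff_sub, coeff_shift, finsum_eq_single _ 0]
  · simp [shiftCoeff_zero]
  · intro k hk
    have : (1 : ℚ) ≤ k := by exact_mod_cast Nat.one_le_iff_ne_zero.2 hk
    rw [h (e - k) (by linarith), mul_zero]

theorem IsBigO.shift {d : ℚ} {f : HahnSeries ℚ F} (h : IsBigO d f) : IsBigO d (shift F f) := by
  have := ((shift_sub_self h).mono (by linarith)).add h
  rwa [sub_add_cancel] at this

theorem IsBigO.shift_pow {d : ℚ} {f : HahnSeries ℚ F} (h : IsBigO d f) (t : ℕ) :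
    IsBigO d ((_root_.shift F ^ t) f) := by
  induction t with
  | zero => exact h
  | succ t ih =>
    rw [_root_.pow_succ', RingHom.mul_def, RingHom.comp_apply]
    exact ih.shift

theorem shift_pow_sub_self {d : ℚ} {f : HahnSeries ℚ F} (h : IsBigO d f) (t : ℕ) :
    IsBigO (d + 1) ((shift F ^ t) f - f) := by
  induction t with
  | zero => simpa using IsBigO.zero
  | succ t ih =>
    rw [_root_.pow_succ', RingHom.mul_def, RingHom.comp_apply]
    have := (shift_sub_self (h.shift_pow t)).add ih
    rwa [sub_add_sub_cancel] at this

theorem IsLead.shift {r : ℚ} {c : F} {f : HahnSeries ℚ F} (h : IsLead r c f) :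
    IsLead r c (shift F f) := by
  have := (shift_sub_self h.isBigO).mono (by linarith : 1 - r ≤ -r + 1) |>.add h
  rwa [sub_add_sub_cancel] at this

theorem IsLead.shift_pow {r : ℚ} {c : F} {f : HahnSeries ℚ F} (h : IsLead r c f) (t : ℕ) :
    IsLead r c ((_root_.shift F ^ t) f) := by
  induction t with
  | zero => exact h
  | succ t ih =>
    rw [_root_.pow_succ', RingHom.mul_def, RingHom.comp_apply]
    exact ih.shift

/-- After removing the constant term, a leading term c z^r would contribute -r c z^(r-1) to the
difference, which forces r = 0, and that term has been removed. -/
theorem eq_C_of_shift_eq_self {f : HahnSeries ℚ F} (h : shift F f = f) :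
    f = C (f.coeff 0) := by
  rw [← sub_eq_zero]
  set g := f - C (f.coeff 0) with hg
  have hgs : shift F g = g := by rw [hg, map_sub, h, shift_C]
  have hg0 : g.coeff 0 = 0 := by simp [hg]
  by_contra hne
  have ho : g.coeff g.order ≠ 0 := mt coeff_order_eq_zero.1 hne
  have hlt : ∀ e < g.order, g.coeff e = 0 := fun e he => coeff_eq_zero_of_lt_order he
  have hc := congrArg (fun u => coeff u (g.order + 1)) hgs
  simp only [coeff_shift] at hc
  rw [finsum_eq_sum_of_support_subset (s := Finset.range 2)] at hc
  · simp only [Finset.sum_range_succ, Finset.sum_range_zero, zero_add, shiftCoeff_zero,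
      shiftCoeff_one, Nat.cast_zero, Nat.cast_one, sub_zero, one_mul, add_sub_cancel_right] at hc
    rw [add_eq_left] at hc
    rcases mul_eq_zero.1 hc with h1 | h1
    · rw [neg_eq_zero, Rat.cast_eq_zero] at h1
      have : g.order = 0 := by linarith
      rw [this] at ho
      exact ho hg0
    · exact ho h1
  · intro k hk
    by_contra hk2
    refine hk ?_
    have : (2 : ℚ) ≤ k := by
      have : 2 ≤ k := by simp at hk2; omega
      exact_mod_cast this
    simp only
    rw [hlt _ (by linarith), mul_zero]

end Shift

/-! ### Solving the scalar difference equation by successive approximation -/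

noncomputable section WaveFunction

variable {F : Type} [Field F]

/-- Coefficientwise limits of sequences converging at unit speed. -/
theorem exists_limit (x : ℕ → HahnSeries ℚ F) (h : ∀ n : ℕ, IsBigO (n : ℚ) (x (n + 1) - x n)) :
    ∃ y, ∀ n : ℕ, IsBigO (n : ℚ) (y - x n) := by
  have hmn : ∀ (n k : ℕ), IsBigO (n : ℚ) (x (n + k) - x n) := by
    intro n k
    induction k with
    | zero => simpa using IsBigO.zero
    | succ k ih =>
      have := ((h (n + k)).mono (d' := n) (by push_cast; linarith [k.cast_nonneg (α := ℚ)])).add ih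
      rwa [sub_add_sub_cancel] at this
  have hcoeff : ∀ (n m : ℕ) (e : ℚ), e < n → n ≤ m → (x m).coeff e = (x n).coeff e := by
    intro n m e he hnm
    obtain ⟨k, rfl⟩ := Nat.exists_eq_add_of_le hnm
    have := hmn n k e he
    rwa [coeff_sub, sub_eq_zero] at this
  -- From the index N e on, the coefficient at e no longer changes.
  let N : ℚ → ℕ := fun e => ⌈e⌉₊ + 1
  have hN : ∀ e, e < N e := fun e => by
    have := Nat.le_ceil e
    push_cast [N]
    linarith
  have hNm : ∀ e e', e ≤ e' → N e ≤ N e' := fun e e' he => by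
    have := Nat.ceil_mono he
    simp only [N]
    omega
  refine ⟨⟨fun e => (x (N e)).coeff e, ?_⟩, fun n e he => ?_⟩
  · rw [Set.isPWO_iff_isWF, Set.isWF_iff_no_descending_seq]
    intro f hf hmem
    -- All exponents of a descending sequence are at most its first one, so the single approximant
    -- with index N (f 0) already has them in its support.
    have hW := (x (N (f 0))).isWF_support
    rw [Set.isWF_iff_no_descending_seq] at hW
    refine hW f hf fun n => ?_
    have h1 := hmem n
    simp only [Function.mem_support] at h1
    have hle := hf.antitone (Nat.zero_le n)
    rwa [← hcoeff _ _ _ (hN (f n)) (hNm _ _ hle)] at h1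
  · rw [coeff_sub, sub_eq_zero]
    rcases le_total n (N e) with hle | hle
    · exact hcoeff _ _ _ he hle
    · exact (hcoeff _ _ _ (hN e) hle).symm

/-- Picard iteration from 0: each step gains one power of z⁻¹, so the iterates converge
coefficientwise at unit speed. -/
theorem exists_fixedPoint (G : HahnSeries ℚ F → HahnSeries ℚ F)
    (hG : ∀ f, IsBigO 1 f → IsBigO 1 (G f))
    (hc : ∀ (d : ℚ) (f g), IsBigO 1 f → IsBigO 1 g → IsBigO d (f - g) →
      IsBigO (d + 1) (G f - G g)) :
    ∃ f, IsBigO 1 f ∧ G f = f := by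
  have h1 : ∀ n : ℕ, IsBigO 1 (G^[n] 0) := fun n => by
    induction n with
    | zero => exact IsBigO.zero
    | succ n ih =>
      rw [Function.iterate_succ_apply']
      exact hG _ ih
  obtain ⟨y, hy⟩ := exists_limit (fun n => G^[n] 0) fun n => by
    induction n with
    | zero => exact ((h1 1).sub (h1 0)).mono (by norm_num)
    | succ n ih =>
      rw [Function.iterate_succ_apply', Function.iterate_succ_apply' G n]
      push_cast
      refine hc n _ _ ?_ (h1 n) ?_
      · rw [← Function.iterate_succ_apply' G n]
        exact h1 (n + 1)
      · rwa [Function.iterate_succ_apply'] at ih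
  have hy1 : IsBigO 1 y := by
    have := ((hy 1).mono (by simp)).add (h1 1)
    rwa [sub_add_cancel] at this
  refine ⟨y, hy1, sub_eq_zero.1 (IsBigO.eq_zero fun n => ?_)⟩
  have h2 := (hc n _ _ hy1 (h1 n) (hy n)).mono (by linarith : (n : ℚ) ≤ n + 1)
  rw [← Function.iterate_succ_apply' G n] at h2
  have h3 := h2.sub ((hy (n + 1)).mono (by push_cast; linarith : (n : ℚ) ≤ _))
  convert h3 using 1
  ring

variable [CharZero F]

/-- Linearisation at 1 of the product of shifts: to leading order the shifts act trivially, so the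
derivative is multiplication by the number of factors. -/
theorem prod_sub_prod {d : ℚ} {f g : HahnSeries ℚ F} (hf : IsBigO 1 f) (hg : IsBigO 1 g)
    (hd : IsBigO d (f - g)) (s : Finset ℕ) :
    IsBigO 1 (∏ t ∈ s, (shift F ^ t) (1 + f) - 1) ∧
      IsBigO (d + 1) (∏ t ∈ s, (shift F ^ t) (1 + f) - ∏ t ∈ s, (shift F ^ t) (1 + g) -
        (s.card : HahnSeries ℚ F) * (f - g)) := by
  induction s using Finset.induction_on with
  | empty => constructor <;> simpa using IsBigO.zero
  | insert a s ha ih =>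
    rw [Finset.prod_insert ha, Finset.prod_insert ha, Finset.card_insert_of_notMem ha]
    obtain ⟨h1, h2⟩ := ih
    set P := ∏ t ∈ s, (shift F ^ t) (1 + f)
    set Q := ∏ t ∈ s, (shift F ^ t) (1 + g)
    have hfa := hf.shift_pow a
    have hga := hg.shift_pow a
    have hda := hd.shift_pow a
    have hdd := shift_pow_sub_self hd a
    have hP : IsBigO 0 P := by
      simpa using (h1.mono (by norm_num)).add IsBigO.one
    have hPQ : IsBigO d (P - Q) := by
      have h3 := (IsBigO.C (s.card : F)).mul hd
      rw [map_natCast, zero_add] at h3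
      have := (h2.mono (by linarith : d ≤ d + 1)).add h3
      rwa [sub_add_cancel] at this
    rw [map_add, map_add, map_one]
    rw [map_sub] at hda hdd
    constructor
    · have := h1.add ((hfa.mul hP).mono (by norm_num))
      convert this using 1
      ring
    · have h4 := ((hdd.add (hda.mul h1)).add h2).add ((hga.mul hPQ).mono (by linarith))
      convert h4 using 1
      push_cast
      ring

/-- The variable `z`. -/
def zVar (F : Type) [Field F] : HahnSeries ℚ F := single (-1) 1

/-- The scalar difference equation satisfied by the multiplier of a formal wave function. -/
theorem exists_multiplier {m : ℕ} (hm : 1 ≤ m) (s t : Finset ℕ) (hs : s.card = m) {c a : F} (b : F)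
    (hc : c ≠ 0) (hca : c ^ m = a) :
    ∃ ξ : HahnSeries ℚ F, IsLead (1 / (m : ℚ)) c ξ ∧
      ∏ i ∈ s, (shift F ^ i) ξ + ∏ i ∈ t, (shift F ^ i) ξ⁻¹ = C a * (zVar F - C b) := by
  have hm0 : (m : ℚ) ≠ 0 := by positivity
  have ha : a ≠ 0 := hca ▸ pow_ne_zero _ hc
  -- The ansatz is ξ = θ (1 + f) with f = O(z⁻¹). Dividing by the product Q₀ of shifts of θ turns
  -- the equation into P f - U + V (T f)⁻¹ = 0, where U = 1 + O(z⁻¹) and V = O(z⁻¹).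
  set θ : HahnSeries ℚ F := single (-(1 / (m : ℚ))) c with hθ
  have hθl : IsLead (1 / (m : ℚ)) c θ := IsLead.single _ _
  set Q₀ := ∏ i ∈ s, (shift F ^ i) θ
  set R₀ := ∏ i ∈ t, (shift F ^ i) θ⁻¹
  have hQ₀ : IsLead 1 a Q₀ := by
    have := IsLead.prod (s := s) fun i _ => hθl.shift_pow i
    rw [hs, hca] at this
    convert this using 1
    field_simp
  have hR₀ : IsBigO 0 R₀ := by
    have := (IsLead.prod (s := t) fun i _ => (hθl.inv hc).shift_pow i).isBigO
    refine this.mono ?_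
    rw [mul_neg, neg_neg]
    positivity
  have hz : IsLead 1 a (C a * (zVar F - C b)) := by
    have h1 : IsLead 1 (1 : F) (zVar F) := IsLead.single 1 1
    have h2 := (h1.add (IsLead.of_isBigO (by simpa using (IsBigO.C b).neg))).C_mul a
    simpa [sub_eq_add_neg] using h2
  have hQi := hQ₀.inv ha
  have hQ0 := hQ₀.ne_zero ha
  set U := C a * (zVar F - C b) * Q₀⁻¹ with hU
  have hU1 : IsBigO 1 (U - 1) := by
    have := hz.mul hQi
    rw [mul_inv_cancel₀ ha, add_neg_cancel, IsLead, sub_zero, neg_zero] at this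
    exact this
  set V := R₀ * Q₀⁻¹ with hV
  have hV1 : IsBigO 1 V := by simpa using hR₀.mul hQi.isBigO
  set P : HahnSeries ℚ F → HahnSeries ℚ F := fun f => ∏ i ∈ s, (shift F ^ i) (1 + f) with hP
  set T : HahnSeries ℚ F → HahnSeries ℚ F := fun f => ∏ i ∈ t, (shift F ^ i) (1 + f) with hT
  have hT1 : ∀ f, IsBigO 1 f → IsLead 0 1 (T f) := fun f hf => by
    have := (prod_sub_prod hf hf (d := 0) (by simpa using IsBigO.zero) t).1
    rw [IsLead, sub_zero, neg_zero]
    exact this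
  have hTi : ∀ f, IsBigO 1 f → IsBigO 0 (T f)⁻¹ := fun f hf => by
    simpa using ((hT1 f hf).inv one_ne_zero).isBigO
  have hmK : (m : HahnSeries ℚ F) ≠ 0 := by
    rw [← map_natCast (C (Γ := ℚ) (R := F))]
    exact C_ne_zero (by exact_mod_cast (by omega : m ≠ 0))
  have hmi : IsBigO 0 (m : HahnSeries ℚ F)⁻¹ := by
    rw [← map_natCast (C (Γ := ℚ) (R := F)), ← map_inv₀]
    exact IsBigO.C _
  -- A Newton step with the derivative frozen at its leading value m: the linear part of P cancels
  -- f, and the factor V makes the remaining term gain an order.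
  obtain ⟨f, hf, hfG⟩ := exists_fixedPoint
      (fun f => f - (m : HahnSeries ℚ F)⁻¹ * (P f - U + V * (T f)⁻¹))
    (fun f hf => by
      have h1 := (prod_sub_prod hf hf (d := 0) (by simpa using IsBigO.zero) s).1
      have h2 : IsBigO 1 (V * (T f)⁻¹) := by simpa using hV1.mul (hTi f hf)
      have h3 := hmi.mul ((h1.sub hU1).add h2)
      rw [zero_add] at h3
      convert hf.sub h3 using 3
      ring)
    (fun d f g hf hg hd => by
      have h1 := (prod_sub_prod hf hg hd s).2
      have h2 := (prod_sub_prod hf hg hd t).2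
      have h3 : IsBigO d (T f - T g) := by
        have h3 := (IsBigO.C (t.card : F)).mul hd
        rw [map_natCast, zero_add] at h3
        have := (h2.mono (by linarith : d ≤ d + 1)).add h3
        rwa [sub_add_cancel] at this
      have h4 : IsBigO (d + 1) (V * (T f)⁻¹ - V * (T g)⁻¹) := by
        have h5 := ((hV1.mul (h3.neg)).mul (hTi f hf)).mul (hTi g hg)
        have h6 := (hT1 f hf).ne_zero one_ne_zero
        have h7 := (hT1 g hg).ne_zero one_ne_zero
        convert h5 using 1
        · ring
        · field_simp
          ring
      have h5 := (hmi.mul (h1.add h4)).neg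
      rw [hs, zero_add] at h5
      convert h5 using 1
      field_simp
      ring)
  have hE : P f - U + V * (T f)⁻¹ = 0 := by
    have := sub_eq_self.1 hfG
    exact (mul_eq_zero.1 this).resolve_left (inv_ne_zero hmK)
  refine ⟨θ * (1 + f), ?_, ?_⟩
  · have h1 : IsLead 0 1 (1 + f) := by
      have := IsLead.one.add (IsLead.of_isBigO (by simpa using hf : IsBigO (1 - 0) f))
      rwa [add_zero] at this
    simpa using hθl.mul h1
  · have h1 : ∏ i ∈ s, (shift F ^ i) (θ * (1 + f)) = Q₀ * P f := by
      simp only [map_mul, Finset.prod_mul_distrib, Q₀, hP]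
    have h2 : ∏ i ∈ t, (shift F ^ i) (θ * (1 + f))⁻¹ = R₀ * (T f)⁻¹ := by
      simp only [mul_inv, map_mul, map_inv₀, Finset.prod_mul_distrib, R₀, hT,
        Finset.prod_inv_distrib]
    have h3 : P f = U - V * (T f)⁻¹ := by linear_combination hE
    rw [h1, h2, h3, hU, hV]
    field_simp
    ring

end WaveFunction

/-! ### Wave functions and dual wave functions of W -/

noncomputable section LaxMatrix

open Matrix

theorem matUnit_mulVec {R : Type} [NonAssocSemiring R] {l i j : ℕ} (hj : 1 ≤ j) (hl : j ≤ l)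
    (v : ℕ → R) (p : Fin l) :
    (matUnit R l i j *ᵥ fun q => v q) p = if (p : ℕ) + 1 = i then v (j - 1) else 0 := by
  rw [mulVec, dotProduct, Finset.sum_eq_single ⟨j - 1, by omega⟩]
  · simp [matUnit, Nat.sub_add_cancel hj]
  · intro q _ hq
    have : ¬ (q : ℕ) + 1 = j := fun h => hq (Fin.ext (by simp; omega))
    simp [matUnit, this]
  · simp

theorem vecMul_matUnit {R : Type} [NonAssocSemiring R] {l i j : ℕ} (hi : 1 ≤ i) (hl : i ≤ l)
    (v : ℕ → R) (q : Fin l) :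
    ((fun p : Fin l => v p) ᵥ* matUnit R l i j) q = if (q : ℕ) + 1 = j then v (i - 1) else 0 := by
  rw [vecMul, dotProduct, Finset.sum_eq_single ⟨i - 1, by omega⟩]
  · simp [matUnit, Nat.sub_add_cancel hi]
  · intro p _ hp
    have : ¬ (p : ℕ) + 1 = i := fun h => hp (Fin.ext (by simp; omega))
    simp [matUnit, this]
  · simp

variable {F : Type} [Field F]

/-- The matrix `W(z,s)` over an arbitrary field of coefficients. -/
def laxMatrix (s : F) (m₁ m₂ : ℕ) : Matrix (Fin (m₁ + m₂)) (Fin (m₁ + m₂)) (HahnSeries ℚ F) :=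
  (zVar F - (C (1 / 2 : F) : HahnSeries ℚ F)) • matUnit (HahnSeries ℚ F) (m₁ + m₂) 1 m₁
    - (C s : HahnSeries ℚ F) • matUnit (HahnSeries ℚ F) (m₁ + m₂) 1 (m₁ + m₂)
    + (C s : HahnSeries ℚ F) • ∑ i ∈ Finset.Icc 2 (m₁ + m₂), matUnit (HahnSeries ℚ F) (m₁ + m₂) i (i - 1)

variable {m₁ m₂ : ℕ}

theorem laxMatrix_mulVec (s : F) (hm₁ : 1 ≤ m₁) (v : ℕ → HahnSeries ℚ F) (p : Fin (m₁ + m₂)) :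
    (laxMatrix s m₁ m₂ *ᵥ fun q => v q) p =
      if (p : ℕ) = 0 then (zVar F - C (1 / 2 : F)) * v (m₁ - 1) - C s * v (m₁ + m₂ - 1)
      else C s * v (p - 1) := by
  have hsum : ∑ i ∈ Finset.Icc 2 (m₁ + m₂),
      (matUnit (HahnSeries ℚ F) (m₁ + m₂) i (i - 1) *ᵥ fun q => v q) p =
        if (p : ℕ) = 0 then 0 else v (p - 1) := by
    rw [Finset.sum_congr rfl fun i hi => matUnit_mulVec (by simp at hi; omega)
      (by simp at hi; omega) v p, Finset.sum_ite_eq]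
    have := p.2
    by_cases h : (p : ℕ) = 0
    · simp [h]
    · rw [if_pos (by simp; omega), if_neg h]
      congr 1
  rw [laxMatrix, add_mulVec, sub_mulVec, smul_mulVec, smul_mulVec, smul_mulVec, sum_mulVec]
  simp only [Pi.add_apply, Pi.sub_apply, Pi.smul_apply, Finset.sum_apply, smul_eq_mul, hsum]
  rw [matUnit_mulVec hm₁ (by omega), matUnit_mulVec (by omega) le_rfl]
  by_cases h : (p : ℕ) = 0 <;> simp [h]

theorem vecMul_laxMatrix (s : F) (hm₁ : 1 ≤ m₁) (hm₂ : 1 ≤ m₂) (v : ℕ → HahnSeries ℚ F)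
    (q : Fin (m₁ + m₂)) :
    ((fun p : Fin (m₁ + m₂) => v p) ᵥ* laxMatrix s m₁ m₂) q =
      if (q : ℕ) + 1 = m₁ then (zVar F - C (1 / 2 : F)) * v 0 + C s * v m₁
      else if (q : ℕ) + 1 = m₁ + m₂ then -(C s * v 0) else C s * v (q + 1) := by
  have hsum : ∑ i ∈ Finset.Icc 2 (m₁ + m₂),
      ((fun p : Fin (m₁ + m₂) => v p) ᵥ* matUnit (HahnSeries ℚ F) (m₁ + m₂) i (i - 1)) q =
        if (q : ℕ) + 1 = m₁ + m₂ then 0 else v (q + 1) := by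
    rw [Finset.sum_congr rfl fun i hi => vecMul_matUnit (by simp at hi; omega)
      (by simp at hi; omega) v q]
    have := q.2
    by_cases h : (q : ℕ) + 1 = m₁ + m₂
    · rw [if_pos h]
      refine Finset.sum_eq_zero fun i hi => if_neg ?_
      simp at hi
      omega
    · rw [if_neg h, Finset.sum_eq_single (q + 2 : ℕ)]
      · simp
      · intro i hi hne
        simp at hi
        exact if_neg (by omega)
      · intro hn
        simp at hn
        omega
  rw [laxMatrix, vecMul_add, vecMul_sub, vecMul_smul, vecMul_smul, vecMul_smul, vecMul_sum]
  simp only [Pi.add_apply, Pi.sub_apply, Pi.smul_apply, Finset.sum_apply, smul_eq_mul, hsum]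
  rw [vecMul_matUnit le_rfl (by omega), vecMul_matUnit le_rfl (by omega)]
  by_cases h : (q : ℕ) + 1 = m₁
  · simp [h, show m₂ ≠ 0 by omega]
  · by_cases h2 : (q : ℕ) + 1 = m₁ + m₂ <;> simp [h, h2, show m₂ ≠ 0 by omega]

variable [CharZero F]

/-- The product `ξ(z) ξ(z - 1) ⋯ ξ(z - n + 1)`. -/
def shiftProd (ξ : HahnSeries ℚ F) (n : ℕ) : HahnSeries ℚ F :=
  ∏ t ∈ Finset.range n, (shift F ^ t) ξ

theorem shiftProd_zero (ξ : HahnSeries ℚ F) : shiftProd ξ 0 = 1 := Finset.prod_range_zero _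

theorem shiftProd_succ (ξ : HahnSeries ℚ F) (n : ℕ) :
    shiftProd ξ (n + 1) = ξ * shift F (shiftProd ξ n) := by
  rw [shiftProd, Finset.prod_range_succ', shiftProd, map_prod, mul_comm]
  simp only [_root_.pow_succ', RingHom.mul_def, RingHom.comp_apply, _root_.pow_zero, RingHom.one_def,
    RingHom.id_apply]

theorem shiftProd_inv (ξ : HahnSeries ℚ F) (n : ℕ) : shiftProd ξ⁻¹ n = (shiftProd ξ n)⁻¹ := by
  simp [shiftProd, map_inv₀]

theorem shiftProd_ne_zero {ξ : HahnSeries ℚ F} (h : ξ ≠ 0) (n : ℕ) : shiftProd ξ n ≠ 0 :=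
  Finset.prod_ne_zero_iff.2 fun t _ => (map_ne_zero (shift F ^ t)).2 h

theorem IsLead.shiftProd {r : ℚ} {c : F} {ξ : HahnSeries ℚ F} (h : IsLead r c ξ) (n : ℕ) :
    IsLead (n * r) (c ^ n) (shiftProd ξ n) := by
  have := IsLead.prod (s := Finset.range n) fun t _ => h.shift_pow t
  rwa [Finset.card_range] at this

theorem shiftProd_mul_prod_Ico (ξ : HahnSeries ℚ F) {m n : ℕ} (h : m ≤ n) :
    shiftProd ξ m * ∏ t ∈ Finset.Ico m n, (shift F ^ t) ξ = shiftProd ξ n :=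
  Finset.prod_range_mul_prod_Ico _ h

/-- The components of the formal wave function with multiplier `s ξ`. -/
def wave (m₁ m₂ : ℕ) (ξ : HahnSeries ℚ F) (p : ℕ) : HahnSeries ℚ F := shiftProd ξ (m₁ + m₂ - 1 - p)

/-- The components of the dual formal wave function with multiplier `s η`. -/
def dualWave (m₁ m₂ : ℕ) (η : HahnSeries ℚ F) (q : ℕ) : HahnSeries ℚ F :=
  if q < m₁ then (shiftProd η (m₁ - 1 - q))⁻¹ else -(shiftProd η (m₁ + (m₁ + m₂ - 1 - q)))⁻¹

/-- Rows other than the first hold because consecutive components differ by one shift and one factor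
ξ. The first row is the scalar equation multiplied by `shiftProd ξ m₂`. -/
theorem laxMatrix_mulVec_wave {s : F} (hs : s ≠ 0) (hm₁ : 1 ≤ m₁) {ξ : HahnSeries ℚ F} (hξ : ξ ≠ 0)
    (h : ∏ t ∈ Finset.Ico m₂ (m₁ + m₂), (shift F ^ t) ξ +
      ∏ t ∈ Finset.range m₂, (shift F ^ t) ξ⁻¹ = C s⁻¹ * (zVar F - C (1 / 2))) :
    (laxMatrix s m₁ m₂ *ᵥ fun p => wave m₁ m₂ ξ p) =
      (C s * ξ) • fun p : Fin (m₁ + m₂) => shift F (wave m₁ m₂ ξ p) := by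
  ext1 p
  rw [laxMatrix_mulVec s hm₁, Pi.smul_apply, smul_eq_mul]
  have hp := p.2
  have hss : (C s : HahnSeries ℚ F) * C s⁻¹ = 1 := by rw [← map_mul, mul_inv_cancel₀ hs, map_one]
  split_ifs with h0
  · rw [h0, wave, wave, wave, mul_assoc, ← shiftProd_succ,
      show m₁ + m₂ - 1 - (m₁ - 1) = m₂ by omega, Nat.sub_self, shiftProd_zero,
      show m₁ + m₂ - 1 - 0 + 1 = m₁ + m₂ by omega]
    have h1 := shiftProd_mul_prod_Ico ξ (show m₂ ≤ m₁ + m₂ by omega)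
    have h2 : shiftProd ξ m₂ * ∏ t ∈ Finset.range m₂, (shift F ^ t) ξ⁻¹ = 1 := by
      change _ * shiftProd ξ⁻¹ m₂ = 1
      rw [shiftProd_inv, mul_inv_cancel₀ (shiftProd_ne_zero hξ _)]
    rw [← h1]
    linear_combination (-(zVar F - C (1 / 2)) * shiftProd ξ m₂) * hss +
      (-C s * shiftProd ξ m₂) * h + C s * h2
  · rw [wave, wave, mul_assoc, ← shiftProd_succ]
    congr 2
    omega

/-- Column m₁ is the scalar equation for η. The last column, with entry -s in the first row, links
the two blocks of the dual vector and accounts for the sign in `dualWave`. The other columns are the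
recursion for `shiftProd`. -/
theorem vecMul_laxMatrix_dualWave {s : F} (hs : s ≠ 0) (hm₁ : 1 ≤ m₁) (hm₂ : 1 ≤ m₂)
    {η : HahnSeries ℚ F} (hη : η ≠ 0)
    (h : ∏ t ∈ Finset.range m₁, (shift F ^ t) η +
      ∏ t ∈ Finset.Ico m₁ (m₁ + m₂), (shift F ^ t) η⁻¹ = C s⁻¹ * (zVar F - C (1 / 2))) :
    ((fun p : Fin (m₁ + m₂) => shift F (dualWave m₁ m₂ η p)) ᵥ* laxMatrix s m₁ m₂) =
      (C s * η) • fun p : Fin (m₁ + m₂) => dualWave m₁ m₂ η p := by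
  ext1 q
  rw [vecMul_laxMatrix s hm₁ hm₂ (fun p => shift F (dualWave m₁ m₂ η p)), Pi.smul_apply,
    smul_eq_mul]
  have hq := q.2
  have hss : (C s : HahnSeries ℚ F) * C s⁻¹ = 1 := by rw [← map_mul, mul_inv_cancel₀ hs, map_one]
  have hstep : ∀ n, shift F (shiftProd η n)⁻¹ = η * (shiftProd η (n + 1))⁻¹ := fun n => by
    rw [shiftProd_succ, map_inv₀]
    have := (map_ne_zero (shift F)).2 (shiftProd_ne_zero hη n)
    field_simp
  have hd0 : dualWave m₁ m₂ η 0 = (shiftProd η (m₁ - 1))⁻¹ := by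
    rw [dualWave, if_pos (by omega), Nat.sub_zero]
  split_ifs with h0 h1
  · rw [hd0, hstep, dualWave, if_neg (lt_irrefl _), map_neg, hstep, dualWave, if_pos (by omega),
      show m₁ - 1 + 1 = m₁ by omega, show m₁ + (m₁ + m₂ - 1 - m₁) + 1 = m₁ + m₂ by omega,
      show m₁ - 1 - q = 0 by omega, shiftProd_zero, inv_one]
    have h1 := shiftProd_mul_prod_Ico η⁻¹ (show m₁ ≤ m₁ + m₂ by omega)
    rw [shiftProd_inv, shiftProd_inv] at h1
    have h2 : (shiftProd η m₁)⁻¹ * ∏ t ∈ Finset.range m₁, (shift F ^ t) η = 1 :=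
      inv_mul_cancel₀ (shiftProd_ne_zero hη _)
    rw [← h1]
    linear_combination (-(zVar F - C (1 / 2)) * η * (shiftProd η m₁)⁻¹) * hss +
      (-C s * η * (shiftProd η m₁)⁻¹) * h + C s * η * h2
  · rw [hd0, hstep, dualWave, if_neg (by omega), show m₁ - 1 + 1 = m₁ by omega,
      show m₁ + m₂ - 1 - q = 0 by omega, Nat.add_zero]
    ring
  · rw [mul_assoc]
    congr 1
    by_cases h2 : (q : ℕ) < m₁
    · rw [dualWave, dualWave, if_pos h2, if_pos (by omega), hstep]
      congr 3
      omega
    · rw [dualWave, dualWave, if_neg h2, if_neg (by omega), map_neg, hstep, mul_neg]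
      congr 4
      omega

end LaxMatrix

/-! ### Leading terms of wave functions, pairings and rank one projectors -/

noncomputable section Asymptotics

variable {F : Type} [Field F] [CharZero F] {m₁ m₂ : ℕ}

/-- A pair of multipliers `s ξ`, `s η` of a formal wave function and of a dual one, with the same
leading term. -/
structure IsWavePair (s : F) (m₁ m₂ : ℕ) (r : ℚ) (c : F) (ξ η : HahnSeries ℚ F) : Prop where
  ne_zero : c ≠ 0
  lead : IsLead r c ξ
  dual_lead : IsLead r c η
  eq : ∏ t ∈ Finset.Ico m₂ (m₁ + m₂), (shift F ^ t) ξ +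
    ∏ t ∈ Finset.range m₂, (shift F ^ t) ξ⁻¹ = C s⁻¹ * (zVar F - C (1 / 2))
  dual_eq : ∏ t ∈ Finset.range m₁, (shift F ^ t) η +
    ∏ t ∈ Finset.Ico m₁ (m₁ + m₂), (shift F ^ t) η⁻¹ = C s⁻¹ * (zVar F - C (1 / 2))

theorem exists_isWavePair_left {s c : F} (hm₁ : 1 ≤ m₁) (hc : c ≠ 0) (h : c ^ m₁ = s⁻¹) :
    ∃ ξ η, IsWavePair s m₁ m₂ (1 / m₁) c ξ η := by
  obtain ⟨ξ, h1, h2⟩ := exists_multiplier hm₁ (Finset.Ico m₂ (m₁ + m₂)) (Finset.range m₂)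
    (by simp) (1 / 2) hc h
  obtain ⟨η, h3, h4⟩ := exists_multiplier hm₁ (Finset.range m₁) (Finset.Ico m₁ (m₁ + m₂))
    (by simp) (1 / 2) hc h
  exact ⟨ξ, η, hc, h1, h3, h2, h4⟩

/-- The second family comes from the same scalar lemma applied to the inverses, with the two
products exchanging roles. -/
theorem exists_isWavePair_right {s c : F} (hm₂ : 1 ≤ m₂) (hc : c ≠ 0) (h : c ^ m₂ = s⁻¹) :
    ∃ ξ η, IsWavePair s m₁ m₂ (-(1 / m₂)) c⁻¹ ξ η := by
  obtain ⟨ξ, h1, h2⟩ := exists_multiplier hm₂ (Finset.range m₂) (Finset.Ico m₂ (m₁ + m₂))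
    (by simp) (1 / 2) hc h
  obtain ⟨η, h3, h4⟩ := exists_multiplier hm₂ (Finset.Ico m₁ (m₁ + m₂)) (Finset.range m₁)
    (by simp) (1 / 2) hc h
  refine ⟨ξ⁻¹, η⁻¹, inv_ne_zero hc, h1.inv hc, h3.inv hc, ?_, ?_⟩
  · rw [inv_inv, add_comm, h2]
  · rw [inv_inv, add_comm, h4]

namespace IsWavePair

variable {s : F} {r : ℚ} {c : F} {ξ η : HahnSeries ℚ F}

theorem lead_wave (h : IsWavePair s m₁ m₂ r c ξ η) {p : ℕ} (hp : p < m₁ + m₂) :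
    IsLead (((m₁ : ℚ) + m₂ - 1 - p) * r) (c ^ ((m₁ : ℤ) + m₂ - 1 - p)) (wave m₁ m₂ ξ p) := by
  have := h.lead.shiftProd (m₁ + m₂ - 1 - p)
  rw [← zpow_natCast] at this
  convert this using 1
  · rw [Nat.cast_sub (by omega), Nat.cast_sub (by omega)]
    push_cast
    ring
  · congr 1
    omega
  · rfl

theorem lead_dualWave_of_lt (h : IsWavePair s m₁ m₂ r c ξ η) {q : ℕ} (hq : q < m₁) :
    IsLead (((q : ℚ) + 1 - m₁) * r) (c ^ ((q : ℤ) + 1 - m₁)) (dualWave m₁ m₂ η q) := by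
  have := (h.dual_lead.shiftProd (m₁ - 1 - q)).inv (pow_ne_zero _ h.ne_zero)
  rw [← zpow_natCast, ← zpow_neg] at this
  rw [dualWave, if_pos hq]
  convert this using 1
  · rw [Nat.cast_sub (by omega), Nat.cast_sub (by omega)]
    push_cast
    ring
  · congr 1
    omega

theorem lead_dualWave_of_le (h : IsWavePair s m₁ m₂ r c ξ η) {q : ℕ} (hq : m₁ ≤ q)
    (hq' : q < m₁ + m₂) :
    IsLead (((q : ℚ) + 1 - m₁ - m₁ - m₂) * r) (-c ^ ((q : ℤ) + 1 - m₁ - m₁ - m₂))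
      (dualWave m₁ m₂ η q) := by
  have := ((h.dual_lead.shiftProd (m₁ + (m₁ + m₂ - 1 - q))).inv (pow_ne_zero _ h.ne_zero)).neg
  rw [← zpow_natCast, ← zpow_neg] at this
  rw [dualWave, if_neg (by omega)]
  convert this using 1
  · rw [Nat.cast_add, Nat.cast_sub (by omega), Nat.cast_sub (by omega)]
    push_cast
    ring
  · congr 2
    omega

theorem lead_mul_of_lt (h : IsWavePair s m₁ m₂ r c ξ η) {p q : ℕ} (hp : p < m₁ + m₂)
    (hq : q < m₁) :
    IsLead (((m₂ : ℚ) + q - p) * r) (c ^ ((m₂ : ℤ) + q - p))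
      (wave m₁ m₂ ξ p * dualWave m₁ m₂ η q) := by
  convert (h.lead_wave hp).mul (h.lead_dualWave_of_lt hq) using 1
  · ring
  · rw [← zpow_add₀ h.ne_zero]
    congr 1
    ring

theorem lead_mul_of_le (h : IsWavePair s m₁ m₂ r c ξ η) {p q : ℕ} (hp : p < m₁ + m₂)
    (hq : m₁ ≤ q) (hq' : q < m₁ + m₂) :
    IsLead (((q : ℚ) - p - m₁) * r) (-c ^ ((q : ℤ) - p - m₁))
      (wave m₁ m₂ ξ p * dualWave m₁ m₂ η q) := by
  convert (h.lead_wave hp).mul (h.lead_dualWave_of_le hq hq') using 1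
  · ring
  · rw [mul_neg, ← zpow_add₀ h.ne_zero]
    congr 2
    ring

end IsWavePair

/-- The pairing of a formal wave function with a dual one. -/
def pairing (m₁ m₂ : ℕ) (η ξ : HahnSeries ℚ F) : HahnSeries ℚ F :=
  ∑ p : Fin (m₁ + m₂), dualWave m₁ m₂ η p * wave m₁ m₂ ξ p

namespace IsWavePair

variable {s : F} {r : ℚ} {c : F} {ξ η : HahnSeries ℚ F}

/-- Within the first m₁ indices, and within the last m₂, the term at index p has a leading term
independent of p, so each block contributes its size times that term. -/
theorem exists_pairing (h : IsWavePair s m₁ m₂ r c ξ η) :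
    ∃ A B, pairing m₁ m₂ η ξ = A + B ∧ IsLead (m₂ * r) (m₁ * c ^ (m₂ : ℤ)) A ∧
      IsLead (-m₁ * r) (-(m₂ * c ^ (-m₁ : ℤ))) B := by
  refine ⟨_, _, Fin.sum_univ_add _, ?_, ?_⟩
  · have : ∀ p ∈ (Finset.univ : Finset (Fin m₁)), IsLead ((m₂ : ℚ) * r) (c ^ (m₂ : ℤ))
        (dualWave m₁ m₂ η (Fin.castAdd m₂ p) * wave m₁ m₂ ξ (Fin.castAdd m₂ p)) := fun p _ => by
      have := h.lead_mul_of_lt (p := p) (q := p) (by omega) p.2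
      rw [mul_comm (dualWave m₁ m₂ η _)]
      simpa using this
    simpa using IsLead.sum this
  · have : ∀ p ∈ (Finset.univ : Finset (Fin m₂)), IsLead (-(m₁ : ℚ) * r) (-c ^ (-m₁ : ℤ))
        (dualWave m₁ m₂ η (Fin.natAdd m₁ p) * wave m₁ m₂ ξ (Fin.natAdd m₁ p)) := fun p _ => by
      have := h.lead_mul_of_le (p := m₁ + p) (q := m₁ + p) (by omega) (by omega) (by omega)
      rw [mul_comm (dualWave m₁ m₂ η _)]
      simpa using this
    simpa using IsLead.sum this

/-- For r = 1/m₁ the second block is O(z⁻¹), a full power of z or more below the first, whose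
exponent m₂/m₁ is nonnegative. In `lead_pairing_right` the blocks trade places. -/
theorem lead_pairing_left (hm₁ : 1 ≤ m₁) (hm₂ : 1 ≤ m₂)
    (h : IsWavePair s m₁ m₂ (1 / m₁) c ξ η) :
    IsLead (m₂ * (1 / m₁)) (m₁ * c ^ (m₂ : ℤ)) (pairing m₁ m₂ η ξ) := by
  obtain ⟨A, B, hAB, hA, hB⟩ := h.exists_pairing
  rw [hAB]
  refine hA.add_of_le hB ?_
  have h1 : (m₁ : ℚ) ≠ 0 := by positivity
  rw [neg_mul, mul_one_div_cancel h1]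
  have : (0 : ℚ) ≤ m₂ * (1 / m₁) := by positivity
  linarith

theorem lead_pairing_right (hm₁ : 1 ≤ m₁) (hm₂ : 1 ≤ m₂)
    (h : IsWavePair s m₁ m₂ (-(1 / m₂)) c ξ η) :
    IsLead (m₁ * (1 / m₂)) (-(m₂ * c ^ (-m₁ : ℤ))) (pairing m₁ m₂ η ξ) := by
  obtain ⟨A, B, hAB, hA, hB⟩ := h.exists_pairing
  rw [neg_mul_neg] at hB
  rw [hAB, add_comm]
  refine hB.add_of_le hA ?_
  have h1 : (m₂ : ℚ) ≠ 0 := by positivity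
  rw [mul_neg, mul_one_div_cancel h1]
  have : (0 : ℚ) ≤ m₁ * (1 / m₂) := by positivity
  linarith

theorem pairing_ne_zero_left (hm₁ : 1 ≤ m₁) (hm₂ : 1 ≤ m₂)
    (h : IsWavePair s m₁ m₂ (1 / m₁) c ξ η) : pairing m₁ m₂ η ξ ≠ 0 :=
  (lead_pairing_left hm₁ hm₂ h).ne_zero
    (mul_ne_zero (by exact_mod_cast (by omega : m₁ ≠ 0)) (zpow_ne_zero _ h.ne_zero))

theorem pairing_ne_zero_right (hm₁ : 1 ≤ m₁) (hm₂ : 1 ≤ m₂)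
    (h : IsWavePair s m₁ m₂ (-(1 / m₂)) c ξ η) : pairing m₁ m₂ η ξ ≠ 0 :=
  (lead_pairing_right hm₁ hm₂ h).ne_zero
    (neg_ne_zero.2 (mul_ne_zero (by exact_mod_cast (by omega : m₂ ≠ 0))
      (zpow_ne_zero _ h.ne_zero)))

/-- The series estimated here is the (p, q) entry of the rank one projector v u / (u v) onto a wave
function of the first family. -/
theorem lead_div_left_of_lt (hm₁ : 1 ≤ m₁) (hm₂ : 1 ≤ m₂)
    (h : IsWavePair s m₁ m₂ (1 / m₁) c ξ η) {p q : ℕ} (hp : p < m₁ + m₂) (hq : q < m₁) :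
    IsLead (((q : ℚ) - p) / m₁) ((m₁ : F)⁻¹ * c ^ ((q : ℤ) - p))
      (wave m₁ m₂ ξ p * ((pairing m₁ m₂ η ξ)⁻¹ * dualWave m₁ m₂ η q)) := by
  have hc := zpow_ne_zero (m₂ : ℤ) h.ne_zero
  have hm : (m₁ : F) ≠ 0 := by exact_mod_cast (by omega : m₁ ≠ 0)
  convert (h.lead_mul_of_lt hp hq).mul
    ((lead_pairing_left hm₁ hm₂ h).inv (mul_ne_zero hm hc)) using 1
  · ring
  · rw [add_sub_assoc, zpow_add₀ h.ne_zero]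
    field_simp
  · ring

/-- As q < m₁ + m₂, the bound is a strictly negative power of z, so these columns of the projector
cannot affect a leading term. -/
theorem isBigO_div_left_of_le (hm₁ : 1 ≤ m₁) (hm₂ : 1 ≤ m₂)
    (h : IsWavePair s m₁ m₂ (1 / m₁) c ξ η) {p q : ℕ} (hp : p < m₁ + m₂) (hq : m₁ ≤ q)
    (hq' : q < m₁ + m₂) :
    IsBigO (((m₁ : ℚ) + m₂ + p - q) / m₁)
      (wave m₁ m₂ ξ p * ((pairing m₁ m₂ η ξ)⁻¹ * dualWave m₁ m₂ η q)) := by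
  have hc := zpow_ne_zero (m₂ : ℤ) h.ne_zero
  have hm : (m₁ : F) ≠ 0 := by exact_mod_cast (by omega : m₁ ≠ 0)
  convert ((h.lead_mul_of_le hp hq hq').mul
    ((lead_pairing_left hm₁ hm₂ h).inv (mul_ne_zero hm hc))).isBigO using 1
  · ring
  · ring

theorem lead_div_right_of_le (hm₁ : 1 ≤ m₁) (hm₂ : 1 ≤ m₂)
    (h : IsWavePair s m₁ m₂ (-(1 / m₂)) c ξ η) {p q : ℕ} (hp : p < m₁ + m₂) (hq : m₁ ≤ q)
    (hq' : q < m₁ + m₂) :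
    IsLead (((p : ℚ) - q) / m₂) ((m₂ : F)⁻¹ * c ^ ((q : ℤ) - p))
      (wave m₁ m₂ ξ p * ((pairing m₁ m₂ η ξ)⁻¹ * dualWave m₁ m₂ η q)) := by
  have hc := zpow_ne_zero (-m₁ : ℤ) h.ne_zero
  have hm : (m₂ : F) ≠ 0 := by exact_mod_cast (by omega : m₂ ≠ 0)
  convert (h.lead_mul_of_le hp hq hq').mul
    ((lead_pairing_right hm₁ hm₂ h).inv (neg_ne_zero.2 (mul_ne_zero hm hc))) using 1
  · ring
  · rw [sub_eq_add_neg _ (m₁ : ℤ), zpow_add₀ h.ne_zero]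
    field_simp
  · ring

theorem isBigO_div_right_of_lt (hm₁ : 1 ≤ m₁) (hm₂ : 1 ≤ m₂)
    (h : IsWavePair s m₁ m₂ (-(1 / m₂)) c ξ η) {p q : ℕ} (hp : p < m₁ + m₂) (hq : q < m₁) :
    IsBigO (((m₁ : ℚ) + m₂ + q - p) / m₂)
      (wave m₁ m₂ ξ p * ((pairing m₁ m₂ η ξ)⁻¹ * dualWave m₁ m₂ η q)) := by
  have hc := zpow_ne_zero (-m₁ : ℤ) h.ne_zero
  have hm : (m₂ : F) ≠ 0 := by exact_mod_cast (by omega : m₂ ≠ 0)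
  convert ((h.lead_mul_of_lt hp hq).mul
    ((lead_pairing_right hm₁ hm₂ h).inv (neg_ne_zero.2 (mul_ne_zero hm hc)))).isBigO using 1
  · ring
  · ring

end IsWavePair

end Asymptotics

/-! ### Solutions as matrices diagonal in the basis of wave functions -/

noncomputable section Spectral

open Matrix

variable {F : Type} [Field F] [CharZero F] {m₁ m₂ : ℕ}

theorem coeff_order_shift (f : HahnSeries ℚ F) : (shift F f).coeff f.order = f.coeff f.order := by
  have := shift_sub_self (IsBigO.order f) f.order (by linarith)
  rwa [coeff_sub, sub_eq_zero] at this

theorem order_shift {f : HahnSeries ℚ F} (hf : f ≠ 0) : (shift F f).order = f.order := by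
  have h := coeff_order_shift f
  have hne : f.coeff f.order ≠ 0 := mt coeff_order_eq_zero.1 hf
  refine le_antisymm (order_le_of_coeff_ne_zero (h ▸ hne)) ?_
  rw [le_order_iff_forall ((map_ne_zero (shift F)).2 hf)]
  exact (IsBigO.order f).shift

theorem leadingCoeff_shift {f : HahnSeries ℚ F} (hf : f ≠ 0) :
    (shift F f).leadingCoeff = f.leadingCoeff := by
  rw [leadingCoeff_eq, order_shift hf, coeff_order_shift, leadingCoeff_eq]

/-- A rank one difference equation has no nonzero solution unless its multiplier is `1` to leading
order. -/
theorem eq_zero_of_shift_mul_eq {f ξ η : HahnSeries ℚ F} {r r' : ℚ} {c c' : F} (hξ : IsLead r c ξ)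
    (hη : IsLead r' c' η) (hc : c ≠ 0) (hc' : c' ≠ 0) (hne : ¬ (r = r' ∧ c = c'))
    (h : shift F f * ξ = η * f) : f = 0 := by
  by_contra hf
  have hf' := (map_ne_zero (shift F)).2 hf
  refine hne ⟨?_, ?_⟩
  · have := congrArg HahnSeries.order h
    rw [order_mul hf' (hξ.ne_zero hc), order_mul (hη.ne_zero hc') hf, order_shift hf,
      hξ.order_eq hc, hη.order_eq hc'] at this
    linarith
  · have := congrArg HahnSeries.leadingCoeff h
    rw [leadingCoeff_mul, leadingCoeff_mul, leadingCoeff_shift hf, hξ.leadingCoeff_eq hc,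
      hη.leadingCoeff_eq hc', mul_comm] at this
    exact mul_right_cancel₀ (leadingCoeff_ne_zero.2 hf) this

/-- The topological difference equation over an arbitrary field of coefficients. -/
def IsEquivariant (s : F) (X : Matrix (Fin (m₁ + m₂)) (Fin (m₁ + m₂)) (HahnSeries ℚ F)) : Prop :=
  X.map (shift F) * laxMatrix s m₁ m₂ = laxMatrix s m₁ m₂ * X

theorem isEquivariant_one (s : F) :
    IsEquivariant s (1 : Matrix (Fin (m₁ + m₂)) (Fin (m₁ + m₂)) (HahnSeries ℚ F)) := by
  rw [IsEquivariant, Matrix.map_one _ (map_zero _) (map_one _), Matrix.one_mul, Matrix.mul_one]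

theorem IsEquivariant.sub {s : F} {X Y : Matrix (Fin (m₁ + m₂)) (Fin (m₁ + m₂)) (HahnSeries ℚ F)}
    (hX : IsEquivariant s X) (hY : IsEquivariant s Y) : IsEquivariant s (X - Y) := by
  rw [IsEquivariant] at *
  rw [Matrix.map_sub _ (map_sub _), Matrix.sub_mul, Matrix.mul_sub, hX, hY]

/-- The vector of components of a formal wave function. -/
def waveVec (m₁ m₂ : ℕ) (ξ : HahnSeries ℚ F) : Fin (m₁ + m₂) → HahnSeries ℚ F :=
  fun p => wave m₁ m₂ ξ p

/-- The vector of components of a dual formal wave function. -/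
def dualWaveVec (m₁ m₂ : ℕ) (η : HahnSeries ℚ F) : Fin (m₁ + m₂) → HahnSeries ℚ F :=
  fun p => dualWave m₁ m₂ η p

theorem dotProduct_waveVec (ξ η : HahnSeries ℚ F) :
    dualWaveVec m₁ m₂ η ⬝ᵥ waveVec m₁ m₂ ξ = pairing m₁ m₂ η ξ := rfl

/-- The expression u(z-1) X(z-1) W(z) v(z) is evaluated in two ways: W acts on v directly, or it is
moved past X by the equation and then acts on u from the right. -/
theorem shift_dotProduct_mulVec {s : F} (hs : s ≠ 0) (hm₁ : 1 ≤ m₁) (hm₂ : 1 ≤ m₂)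
    {r r' : ℚ} {c c' : F} {ξ ξ' η η' : HahnSeries ℚ F} (h : IsWavePair s m₁ m₂ r c ξ ξ')
    (h' : IsWavePair s m₁ m₂ r' c' η' η)
    {X : Matrix (Fin (m₁ + m₂)) (Fin (m₁ + m₂)) (HahnSeries ℚ F)} (hX : IsEquivariant s X) :
    shift F (dualWaveVec m₁ m₂ η ⬝ᵥ X *ᵥ waveVec m₁ m₂ ξ) * ξ =
      η * (dualWaveVec m₁ m₂ η ⬝ᵥ X *ᵥ waveVec m₁ m₂ ξ) := by
  have h1 := laxMatrix_mulVec_wave hs hm₁ (h.lead.ne_zero h.ne_zero) h.eq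
  have h2 := vecMul_laxMatrix_dualWave hs hm₁ hm₂ (h'.dual_lead.ne_zero h'.ne_zero) h'.dual_eq
  have hC : (C s : HahnSeries ℚ F) ≠ 0 := C_ne_zero hs
  have h3 : shift F (dualWaveVec m₁ m₂ η ⬝ᵥ X *ᵥ waveVec m₁ m₂ ξ) =
      (fun p : Fin (m₁ + m₂) => shift F (dualWave m₁ m₂ η p)) ⬝ᵥ
        X.map (shift F) *ᵥ fun p => shift F (wave m₁ m₂ ξ p) := by
    rw [RingHom.map_dotProduct]
    congr 1
    exact funext fun p => RingHom.map_mulVec (shift F) X _ p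
  refine mul_left_cancel₀ hC ?_
  calc C s * (shift F (dualWaveVec m₁ m₂ η ⬝ᵥ X *ᵥ waveVec m₁ m₂ ξ) * ξ)
      = (fun p : Fin (m₁ + m₂) => shift F (dualWave m₁ m₂ η p)) ⬝ᵥ
          X.map (shift F) *ᵥ ((C s * ξ) • fun p : Fin (m₁ + m₂) => shift F (wave m₁ m₂ ξ p)) := by
        rw [h3, mulVec_smul, dotProduct_smul, smul_eq_mul]
        ring
    _ = ((fun p : Fin (m₁ + m₂) => shift F (dualWave m₁ m₂ η p)) ᵥ* laxMatrix s m₁ m₂) ⬝ᵥ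
          X *ᵥ waveVec m₁ m₂ ξ := by
        rw [← h1, mulVec_mulVec, hX, ← mulVec_mulVec, dotProduct_mulVec]
        rfl
    _ = C s * (η * (dualWaveVec m₁ m₂ η ⬝ᵥ X *ᵥ waveVec m₁ m₂ ξ)) := by
        rw [h2, smul_dotProduct, smul_eq_mul, mul_assoc]
        rfl

/-- A complete system of formal wave functions with their duals. -/
structure IsWaveBasis (s : F) (m₁ m₂ : ℕ) (r : Fin m₁ ⊕ Fin m₂ → ℚ) (c : Fin m₁ ⊕ Fin m₂ → F)
    (ξ η : Fin m₁ ⊕ Fin m₂ → HahnSeries ℚ F) : Prop where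
  s_ne_zero : s ≠ 0
  left_pos : 1 ≤ m₁
  right_pos : 1 ≤ m₂
  pair : ∀ i, IsWavePair s m₁ m₂ (r i) (c i) (ξ i) (η i)
  pairing_ne_zero : ∀ i, pairing m₁ m₂ (η i) (ξ i) ≠ 0
  injective : ∀ i j, r i = r j → c i = c j → i = j

/-- The matrix whose columns are the given formal wave functions. -/
def waveMatrix (m₁ m₂ : ℕ) (ξ : Fin m₁ ⊕ Fin m₂ → HahnSeries ℚ F) :
    Matrix (Fin (m₁ + m₂)) (Fin m₁ ⊕ Fin m₂) (HahnSeries ℚ F) :=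
  Matrix.of fun p i => wave m₁ m₂ (ξ i) p

/-- The matrix whose rows are the normalized dual formal wave functions. -/
def dualWaveMatrix (m₁ m₂ : ℕ) (ξ η : Fin m₁ ⊕ Fin m₂ → HahnSeries ℚ F) :
    Matrix (Fin m₁ ⊕ Fin m₂) (Fin (m₁ + m₂)) (HahnSeries ℚ F) :=
  Matrix.of fun i q => (pairing m₁ m₂ (η i) (ξ i))⁻¹ * dualWave m₁ m₂ (η i) q

/-- The matrix acting on the `i`-th formal wave function as multiplication by the constant `d i`. -/
def spectral (m₁ m₂ : ℕ) (ξ η : Fin m₁ ⊕ Fin m₂ → HahnSeries ℚ F) (d : Fin m₁ ⊕ Fin m₂ → F) :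
    Matrix (Fin (m₁ + m₂)) (Fin (m₁ + m₂)) (HahnSeries ℚ F) :=
  waveMatrix m₁ m₂ ξ *
    (diagonal fun i => C (d i) : Matrix (Fin m₁ ⊕ Fin m₂) (Fin m₁ ⊕ Fin m₂) (HahnSeries ℚ F)) *
    dualWaveMatrix m₁ m₂ ξ η

theorem spectral_apply (ξ η : Fin m₁ ⊕ Fin m₂ → HahnSeries ℚ F) (d : Fin m₁ ⊕ Fin m₂ → F)
    (p q : Fin (m₁ + m₂)) :
    spectral m₁ m₂ ξ η d p q = ∑ i, C (d i) *
      (wave m₁ m₂ (ξ i) p * ((pairing m₁ m₂ (η i) (ξ i))⁻¹ * dualWave m₁ m₂ (η i) q)) := by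
  rw [spectral, Matrix.mul_apply]
  refine Finset.sum_congr rfl fun i _ => ?_
  rw [mul_diagonal, waveMatrix, dualWaveMatrix, of_apply, of_apply]
  ring

theorem spectral_smul (ξ η : Fin m₁ ⊕ Fin m₂ → HahnSeries ℚ F) (d : Fin m₁ ⊕ Fin m₂ → F) (a : F) :
    spectral m₁ m₂ ξ η (fun i => a * d i) = (C a : HahnSeries ℚ F) • spectral m₁ m₂ ξ η d := by
  ext1 p q
  rw [Matrix.smul_apply, spectral_apply, spectral_apply, smul_eq_mul, Finset.mul_sum]
  refine Finset.sum_congr rfl fun i _ => ?_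
  rw [map_mul]
  ring

theorem spectral_zero (ξ η : Fin m₁ ⊕ Fin m₂ → HahnSeries ℚ F) :
    spectral m₁ m₂ ξ η (fun _ => 0) = 0 := by
  ext1 p q
  rw [spectral_apply]
  simp

theorem dualWaveMatrix_mul_mul_apply (ξ η : Fin m₁ ⊕ Fin m₂ → HahnSeries ℚ F)
    (X : Matrix (Fin (m₁ + m₂)) (Fin (m₁ + m₂)) (HahnSeries ℚ F)) (i j : Fin m₁ ⊕ Fin m₂) :
    (dualWaveMatrix m₁ m₂ ξ η * (X * waveMatrix m₁ m₂ ξ)) i j =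
      (pairing m₁ m₂ (η i) (ξ i))⁻¹ *
        (dualWaveVec m₁ m₂ (η i) ⬝ᵥ X *ᵥ waveVec m₁ m₂ (ξ j)) := by
  rw [Matrix.mul_apply, dotProduct, Finset.mul_sum]
  refine Finset.sum_congr rfl fun p _ => ?_
  rw [dualWaveMatrix, of_apply, mul_assoc]
  rfl

namespace IsWaveBasis

variable {s : F} {r : Fin m₁ ⊕ Fin m₂ → ℚ} {c : Fin m₁ ⊕ Fin m₂ → F}
  {ξ η : Fin m₁ ⊕ Fin m₂ → HahnSeries ℚ F}

/-- Distinct wave functions have distinct leading terms, so the off-diagonal entries solve a rank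
one equation with no nonzero solution; the diagonal ones are shift-invariant. -/
theorem exists_diagonal (h : IsWaveBasis s m₁ m₂ r c ξ η)
    {X : Matrix (Fin (m₁ + m₂)) (Fin (m₁ + m₂)) (HahnSeries ℚ F)} (hX : IsEquivariant s X) :
    ∃ d : Fin m₁ ⊕ Fin m₂ → F,
      dualWaveMatrix m₁ m₂ ξ η * (X * waveMatrix m₁ m₂ ξ) = diagonal fun i => C (d i) := by
  refine ⟨fun i => ((dualWaveMatrix m₁ m₂ ξ η * (X * waveMatrix m₁ m₂ ξ)) i i).coeff 0, ?_⟩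
  ext1 i j
  have hij := fun i j => shift_dotProduct_mulVec h.s_ne_zero h.left_pos h.right_pos (h.pair j)
    (h.pair i) hX
  by_cases heq : i = j
  · subst heq
    rw [diagonal_apply_eq]
    refine eq_C_of_shift_eq_self ?_
    have h1 := hij i i
    -- With X = 1 this is the equation of the pairing itself. It has the same multipliers as `h1`,
    -- so the quotient of the two is shift-invariant.
    have h2 := shift_dotProduct_mulVec h.s_ne_zero h.left_pos h.right_pos (h.pair i)
      (h.pair i) (isEquivariant_one s)
    rw [one_mulVec, dotProduct_waveVec] at h2
    have h3 := h.pairing_ne_zero i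
    have h4 := (map_ne_zero (shift F)).2 h3
    have h5 := (h.pair i).lead.ne_zero (h.pair i).ne_zero
    have h6 := (h.pair i).dual_lead.ne_zero (h.pair i).ne_zero
    rw [dualWaveMatrix_mul_mul_apply, map_mul, map_inv₀]
    generalize shift F (dualWaveVec m₁ m₂ (η i) ⬝ᵥ X *ᵥ waveVec m₁ m₂ (ξ i)) = a at *
    generalize shift F (pairing m₁ m₂ (η i) (ξ i)) = b at *
    rw [inv_mul_eq_div, inv_mul_eq_div, div_eq_div_iff h4 h3]
    refine mul_left_cancel₀ (mul_ne_zero h5 h6) ?_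
    linear_combination (η i * pairing m₁ m₂ (η i) (ξ i)) * h1 -
      (η i * (dualWaveVec m₁ m₂ (η i) ⬝ᵥ X *ᵥ waveVec m₁ m₂ (ξ i))) * h2
  · rw [diagonal_apply_ne _ heq, dualWaveMatrix_mul_mul_apply,
      eq_zero_of_shift_mul_eq (h.pair j).lead (h.pair i).dual_lead (h.pair j).ne_zero
        (h.pair i).ne_zero (fun hrc => heq (h.injective j i hrc.1 hrc.2).symm) (hij i j), mul_zero]

/-- Biorthogonality is the diagonal form of the identity matrix, which solves the equation; the
normalisation by the pairing makes its eigenvalues 1. -/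
theorem dualWaveMatrix_mul (h : IsWaveBasis s m₁ m₂ r c ξ η) :
    dualWaveMatrix m₁ m₂ ξ η * waveMatrix m₁ m₂ ξ = 1 := by
  obtain ⟨d, hd⟩ := h.exists_diagonal (isEquivariant_one s)
  rw [Matrix.one_mul] at hd
  rw [hd, ← diagonal_one]
  congr 1
  funext i
  have := congrFun (congrFun hd i) i
  rw [diagonal_apply_eq] at this
  rw [← this, ← Matrix.one_mul (waveMatrix m₁ m₂ ξ), dualWaveMatrix_mul_mul_apply, one_mulVec,
    dotProduct_waveVec, inv_mul_cancel₀ (h.pairing_ne_zero i)]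

theorem waveMatrix_mul (h : IsWaveBasis s m₁ m₂ r c ξ η) :
    waveMatrix m₁ m₂ ξ * dualWaveMatrix m₁ m₂ ξ η = 1 :=
  (mul_eq_one_comm_of_card_eq _ _ _ (by simp)).1 h.dualWaveMatrix_mul

theorem exists_eq_spectral (h : IsWaveBasis s m₁ m₂ r c ξ η)
    {X : Matrix (Fin (m₁ + m₂)) (Fin (m₁ + m₂)) (HahnSeries ℚ F)} (hX : IsEquivariant s X) :
    ∃ d, X = spectral m₁ m₂ ξ η d := by
  obtain ⟨d, hd⟩ := h.exists_diagonal hX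
  refine ⟨d, ?_⟩
  rw [spectral, ← hd, ← Matrix.mul_assoc, h.waveMatrix_mul, Matrix.one_mul, Matrix.mul_assoc,
    h.waveMatrix_mul, Matrix.mul_one]

theorem spectral_mul_waveMatrix (h : IsWaveBasis s m₁ m₂ r c ξ η) (d : Fin m₁ ⊕ Fin m₂ → F) :
    spectral m₁ m₂ ξ η d * waveMatrix m₁ m₂ ξ = waveMatrix m₁ m₂ ξ *
      (diagonal fun i => C (d i) : Matrix (Fin m₁ ⊕ Fin m₂) (Fin m₁ ⊕ Fin m₂) (HahnSeries ℚ F)) := by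
  rw [spectral, Matrix.mul_assoc, h.dualWaveMatrix_mul, Matrix.mul_one]

theorem spectral_mul (h : IsWaveBasis s m₁ m₂ r c ξ η) (d d' : Fin m₁ ⊕ Fin m₂ → F) :
    spectral m₁ m₂ ξ η d * spectral m₁ m₂ ξ η d' = spectral m₁ m₂ ξ η fun i => d i * d' i := by
  rw [spectral, spectral, spectral, Matrix.mul_assoc, Matrix.mul_assoc _ _ (dualWaveMatrix m₁ m₂ ξ η),
    ← Matrix.mul_assoc (dualWaveMatrix m₁ m₂ ξ η), h.dualWaveMatrix_mul, Matrix.one_mul,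
    ← Matrix.mul_assoc, Matrix.mul_assoc _ (diagonal _) (diagonal _), diagonal_mul_diagonal]
  simp only [map_mul]

theorem spectral_one (h : IsWaveBasis s m₁ m₂ r c ξ η) : spectral m₁ m₂ ξ η (fun _ => 1) = 1 := by
  simp only [spectral, map_one, diagonal_one, Matrix.mul_one, h.waveMatrix_mul]

theorem spectral_pow (h : IsWaveBasis s m₁ m₂ r c ξ η) (d : Fin m₁ ⊕ Fin m₂ → F) (n : ℕ) :
    spectral m₁ m₂ ξ η d ^ n = spectral m₁ m₂ ξ η fun i => d i ^ n := by
  induction n with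
  | zero => simpa using h.spectral_one.symm
  | succ n ih =>
    rw [_root_.pow_succ, ih, h.spectral_mul]
    simp only [_root_.pow_succ]

theorem trace_spectral (h : IsWaveBasis s m₁ m₂ r c ξ η) (d : Fin m₁ ⊕ Fin m₂ → F) :
    (spectral m₁ m₂ ξ η d).trace = C (∑ i, d i) := by
  rw [spectral, trace_mul_comm, ← Matrix.mul_assoc, h.dualWaveMatrix_mul, Matrix.one_mul,
    trace_diagonal, map_sum]

theorem waveMatrix_last (h : IsWaveBasis s m₁ m₂ r c ξ η) (i : Fin m₁ ⊕ Fin m₂) :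
    ∃ p, waveMatrix m₁ m₂ ξ p i = 1 :=
  ⟨⟨m₁ + m₂ - 1, by have := h.left_pos; omega⟩, by
    rw [waveMatrix, of_apply, wave, Nat.sub_self, shiftProd_zero]⟩

/-- The i-th wave function is a nonzero vector of the kernel, its last component being 1. -/
theorem det_spectral (h : IsWaveBasis s m₁ m₂ r c ξ η) {d : Fin m₁ ⊕ Fin m₂ → F}
    {i : Fin m₁ ⊕ Fin m₂} (hd : d i = 0) : (spectral m₁ m₂ ξ η d).det = 0 := by
  refine exists_mulVec_eq_zero_iff.1 ⟨fun p => waveMatrix m₁ m₂ ξ p i, ?_, ?_⟩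
  · obtain ⟨p, hp⟩ := h.waveMatrix_last i
    intro h0
    have := congrFun h0 p
    rw [hp] at this
    exact one_ne_zero this
  · funext p
    have := congrFun (congrFun (h.spectral_mul_waveMatrix d) p) i
    rw [mul_diagonal, hd, map_zero, mul_zero] at this
    exact this

/-- With Ψ the matrix of wave functions, W Ψ = Ψ(z-1) E for the diagonal matrix E of multipliers,
and dually Φ(z-1) W = E Φ. Since D is constant and commutes with E, the matrix Ψ D Φ solves the
equation. -/
theorem isEquivariant_spectral (h : IsWaveBasis s m₁ m₂ r c ξ η) (d : Fin m₁ ⊕ Fin m₂ → F) :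
    IsEquivariant s (spectral m₁ m₂ ξ η d) := by
  set Ψ := waveMatrix m₁ m₂ ξ with hΨ
  set Φ := dualWaveMatrix m₁ m₂ ξ η with hΦ
  set W := laxMatrix s m₁ m₂ with hW
  set D : Matrix (Fin m₁ ⊕ Fin m₂) (Fin m₁ ⊕ Fin m₂) (HahnSeries ℚ F) :=
    diagonal fun i => C (d i) with hD
  set E : Matrix (Fin m₁ ⊕ Fin m₂) (Fin m₁ ⊕ Fin m₂) (HahnSeries ℚ F) :=
    diagonal fun i => C s * ξ i with hE
  have h1 : W * Ψ = Ψ.map (shift F) * E := by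
    ext1 p i
    have := congrFun (laxMatrix_mulVec_wave h.s_ne_zero h.left_pos
      ((h.pair i).lead.ne_zero (h.pair i).ne_zero) (h.pair i).eq) p
    rw [mul_diagonal]
    exact this.trans (mul_comm _ _)
  have h2 : Φ.map (shift F) * Ψ.map (shift F) = 1 := by
    rw [← Matrix.map_mul, h.dualWaveMatrix_mul, Matrix.map_one _ (map_zero _) (map_one _)]
  have h3 : Φ.map (shift F) * W = E * Φ := by
    rw [← Matrix.mul_one (Φ.map (shift F) * W), ← h.waveMatrix_mul, ← Matrix.mul_assoc,
      Matrix.mul_assoc _ W, h1, ← Matrix.mul_assoc, h2, Matrix.one_mul]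
  have h4 : D.map (shift F) = D := by
    rw [hD, diagonal_map (map_zero _)]
    congr 1
    funext i
    exact shift_C _
  have h5 : D * E = E * D := by
    rw [hD, hE, diagonal_mul_diagonal, diagonal_mul_diagonal]
    simp only [mul_comm]
  rw [IsEquivariant, spectral, Matrix.map_mul, Matrix.map_mul, h4, Matrix.mul_assoc, h3,
    Matrix.mul_assoc, ← Matrix.mul_assoc D, h5, Matrix.mul_assoc Ψ, ← Matrix.mul_assoc W, h1]
  simp only [Matrix.mul_assoc]
  rfl

/-- A nonzero eigenvalue would give v = d⁻¹ X v, and iterating this makes v decay faster than every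
power of z, although its last component is 1. -/
theorem eq_zero_of_isBigO (h : IsWaveBasis s m₁ m₂ r c ξ η)
    {X : Matrix (Fin (m₁ + m₂)) (Fin (m₁ + m₂)) (HahnSeries ℚ F)} (hX : IsEquivariant s X)
    {δ : ℚ} (hδ : 0 < δ) (hO : ∀ p q, IsBigO δ (X p q)) : X = 0 := by
  obtain ⟨d, rfl⟩ := h.exists_eq_spectral hX
  suffices hd : d = fun _ => 0 by rw [hd, spectral_zero]
  funext i
  by_contra hdi
  obtain ⟨D, hD⟩ := (Set.finite_range fun p => (waveMatrix m₁ m₂ ξ p i).order).bddBelow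
  have key : ∀ n : ℕ, ∀ p, IsBigO (D + n * δ) (waveMatrix m₁ m₂ ξ p i) := by
    intro n
    induction n with
    | zero =>
      intro p
      exact (IsBigO.order _).mono (by simpa using hD ⟨p, rfl⟩)
    | succ n ih =>
      intro p
      have h1 := congrFun (congrFun (h.spectral_mul_waveMatrix d) p) i
      rw [mul_diagonal, Matrix.mul_apply] at h1
      have h2 := (IsBigO.sum (s := Finset.univ) fun q _ => (hO p q).mul (ih q)).mul
        (IsBigO.C (d i)⁻¹)
      rw [h1, mul_assoc, ← map_mul, mul_inv_cancel₀ hdi, map_one, mul_one] at h2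
      refine h2.mono ?_
      push_cast
      linarith
  obtain ⟨p, hp⟩ := h.waveMatrix_last i
  obtain ⟨n, hn⟩ := exists_nat_gt (-D / δ)
  have := key n p 0 (by
    rw [div_lt_iff₀ hδ] at hn
    linarith)
  rw [hp, coeff_one, if_pos rfl] at this
  exact one_ne_zero this

end IsWaveBasis

end Spectral

/-! ### Roots of 1/s, the eigenvalues of the basic solutions and their leading terms -/

noncomputable section WaveBasis

variable {F : Type} [Field F] {m₁ m₂ : ℕ}

theorem sum_zpow_mul_rootOfUnity {m : ℕ} (hm : 1 ≤ m) {c ω : F} (hω : IsPrimitiveRoot ω m) (n : ℤ) :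
    ∑ i : Fin m, (c * ω ^ (i : ℕ)) ^ n = if (m : ℤ) ∣ n then m * c ^ n else 0 := by
  have h0 : ω ≠ 0 := hω.ne_zero (by omega)
  have h : ∀ i : Fin m, (c * ω ^ (i : ℕ)) ^ n = c ^ n * (ω ^ n) ^ (i : ℕ) := fun i => by
    rw [mul_zpow, ← zpow_natCast, ← zpow_natCast, ← zpow_mul, ← zpow_mul, mul_comm n]
  rw [Finset.sum_congr rfl fun i _ => h i, ← Finset.mul_sum,
    Fin.sum_univ_eq_sum_range (fun i => (ω ^ n) ^ i)]
  split_ifs with hd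
  · rw [(hω.zpow_eq_one_iff_dvd n).2 hd]
    simp [mul_comm]
  · have h1 : ω ^ n ≠ 1 := fun h => hd ((hω.zpow_eq_one_iff_dvd n).1 h)
    have h2 : (ω ^ n) ^ m = 1 := by
      rw [← zpow_natCast, ← zpow_mul, mul_comm, zpow_mul, zpow_natCast, hω.pow_eq_one, one_zpow]
    have h3 := geom_sum_mul (ω ^ n) m
    rw [h2, sub_self] at h3
    rw [(mul_eq_zero.1 h3).resolve_right (sub_ne_zero.2 h1), mul_zero]

/-- Roots needed to write down the leading terms of all formal wave functions. -/
structure IsRootData (s : F) (m₁ m₂ : ℕ) (c₁ ω₁ c₂ ω₂ : F) : Prop where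
  s_ne_zero : s ≠ 0
  left_pos : 1 ≤ m₁
  right_pos : 1 ≤ m₂
  left_pow : c₁ ^ m₁ = s⁻¹
  right_pow : c₂ ^ m₂ = s⁻¹
  left_root : IsPrimitiveRoot ω₁ m₁
  right_root : IsPrimitiveRoot ω₂ m₂

/-- The exponents of the leading terms of the multipliers. -/
def multiplierExp (m₁ m₂ : ℕ) : Fin m₁ ⊕ Fin m₂ → ℚ :=
  Sum.elim (fun _ => 1 / (m₁ : ℚ)) fun _ => -(1 / (m₂ : ℚ))

/-- The coefficients of the leading terms of the multipliers. -/
def multiplierCoeff (m₁ m₂ : ℕ) (c₁ ω₁ c₂ ω₂ : F) : Fin m₁ ⊕ Fin m₂ → F :=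
  Sum.elim (fun i => c₁ * ω₁ ^ (i : ℕ)) fun i => (c₂ * ω₂ ^ (i : ℕ))⁻¹

/-- The eigenvalues of the `a`-th basic solution on the formal wave functions. -/
def basicWeight (s : F) (m₁ m₂ : ℕ) (c₁ ω₁ c₂ ω₂ : F) (a : ℕ) : Fin m₁ ⊕ Fin m₂ → F :=
  if a ≤ m₁ then Sum.elim (fun i => s * (c₁ * ω₁ ^ (i : ℕ)) ^ a) fun _ => 0
  else Sum.elim (fun _ => 0) fun i => -s * (c₂ * ω₂ ^ (i : ℕ)) ^ (m₁ + m₂ - a)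

/-- The leading coefficients of the `a`-th basic solution, over an arbitrary field. -/
def basicLeading (F : Type) [Field F] (m₁ a p q : ℕ) : F :=
  if a ≤ m₁ then if q = m₁ - a + p ∧ p < a then 1 else 0
  else if m₁ ≤ q ∧ p = a + (q - m₁) then -1 else 0

theorem basicWeight_mul_basicWeight (s c₁ ω₁ c₂ ω₂ : F) {a b : ℕ} (ham : a ≤ m₁) (hbm : m₁ < b)
    (i : Fin m₁ ⊕ Fin m₂) :
    basicWeight s m₁ m₂ c₁ ω₁ c₂ ω₂ a i * basicWeight s m₁ m₂ c₁ ω₁ c₂ ω₂ b i = 0 := by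
  rcases i with i | i <;> simp [basicWeight, ham, not_le.2 hbm]

theorem exists_basicWeight_eq_zero (hm₁ : 1 ≤ m₁) (hm₂ : 1 ≤ m₂) (s c₁ ω₁ c₂ ω₂ : F) (a : ℕ) :
    ∃ i, basicWeight s m₁ m₂ c₁ ω₁ c₂ ω₂ a i = 0 := by
  by_cases ham : a ≤ m₁
  · exact ⟨Sum.inr ⟨0, hm₂⟩, by simp [basicWeight, ham]⟩
  · exact ⟨Sum.inl ⟨0, hm₁⟩, by simp [basicWeight, ham]⟩

namespace IsRootData

variable {s c₁ ω₁ c₂ ω₂ : F}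

theorem left_ne_zero (h : IsRootData s m₁ m₂ c₁ ω₁ c₂ ω₂) (i : ℕ) : c₁ * ω₁ ^ i ≠ 0 := by
  have := h.left_pos
  refine mul_ne_zero ?_ (pow_ne_zero _ (h.left_root.ne_zero (by omega)))
  rintro rfl
  have h1 := h.left_pow
  rw [zero_pow (by omega)] at h1
  exact inv_ne_zero h.s_ne_zero h1.symm

theorem right_ne_zero (h : IsRootData s m₁ m₂ c₁ ω₁ c₂ ω₂) (i : ℕ) : c₂ * ω₂ ^ i ≠ 0 := by
  have := h.right_pos
  refine mul_ne_zero ?_ (pow_ne_zero _ (h.right_root.ne_zero (by omega)))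
  rintro rfl
  have h1 := h.right_pow
  rw [zero_pow (by omega)] at h1
  exact inv_ne_zero h.s_ne_zero h1.symm

/-- Only a = m₁ survives the sum over roots of unity, giving s m₁ c₁^m₁ = m₁; on the other side 0 <
m₁ + m₂ - a < m₂ excludes divisibility by m₂. -/
theorem sum_basicWeight (h : IsRootData s m₁ m₂ c₁ ω₁ c₂ ω₂) {a : ℕ} (ha : 1 ≤ a)
    (hal : a < m₁ + m₂) :
    ∑ i, basicWeight s m₁ m₂ c₁ ω₁ c₂ ω₂ a i = if a = m₁ then (m₁ : F) else 0 := by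
  rw [Fintype.sum_sum_type, basicWeight]
  by_cases ham : a ≤ m₁
  · simp only [if_pos ham, Sum.elim_inl, Sum.elim_inr, Finset.sum_const_zero, add_zero,
      ← Finset.mul_sum]
    have := sum_zpow_mul_rootOfUnity h.left_pos (c := c₁) h.left_root a
    simp only [zpow_natCast] at this
    rw [this]
    by_cases hEq : a = m₁
    · subst hEq
      rw [if_pos (dvd_refl _), if_pos rfl, h.left_pow]
      field_simp [h.s_ne_zero]
    · rw [if_neg hEq, if_neg, mul_zero]
      intro hd
      exact hEq (le_antisymm ham (Nat.le_of_dvd ha (Int.natCast_dvd_natCast.1 hd)))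
  · simp only [if_neg ham, Sum.elim_inl, Sum.elim_inr, Finset.sum_const_zero, zero_add,
      ← Finset.mul_sum]
    have := sum_zpow_mul_rootOfUnity h.right_pos (c := c₂) h.right_root (m₁ + m₂ - a : ℕ)
    simp only [zpow_natCast] at this
    rw [this, if_neg, mul_zero, if_neg (by omega)]
    intro hd
    have := Nat.le_of_dvd (by omega) (Int.natCast_dvd_natCast.1 hd)
    omega

theorem basicWeight_eq_left (h : IsRootData s m₁ m₂ c₁ ω₁ c₂ ω₂) {a : ℕ} (ha : 1 ≤ a)
    (ham : a ≤ m₁) (i : Fin m₁ ⊕ Fin m₂) :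
    basicWeight s m₁ m₂ c₁ ω₁ c₂ ω₂ a i =
      s ^ (1 - (a : ℤ)) * basicWeight s m₁ m₂ c₁ ω₁ c₂ ω₂ 1 i ^ a := by
  have hs := h.s_ne_zero
  rcases i with i | i
  · simp only [basicWeight, if_pos ham, if_pos h.left_pos, Sum.elim_inl, _root_.pow_one]
    rw [_root_.mul_pow s _ a, ← mul_assoc, ← zpow_natCast s a, ← zpow_add₀ hs, sub_add_cancel,
      zpow_one]
  · simp only [basicWeight, if_pos ham, if_pos h.left_pos, Sum.elim_inr]
    rw [zero_pow (by omega), mul_zero]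

theorem basicWeight_eq_right (h : IsRootData s m₁ m₂ c₁ ω₁ c₂ ω₂) {a : ℕ} (ham : m₁ < a)
    (hal : a < m₁ + m₂) (i : Fin m₁ ⊕ Fin m₂) :
    basicWeight s m₁ m₂ c₁ ω₁ c₂ ω₂ a i = (-s) ^ (1 - ((m₁ : ℤ) + m₂) + a) *
      basicWeight s m₁ m₂ c₁ ω₁ c₂ ω₂ (m₁ + m₂ - 1) i ^ (m₁ + m₂ - a) := by
  have hs := neg_ne_zero.2 h.s_ne_zero
  have h1 : ¬ m₁ + m₂ - 1 ≤ m₁ := by omega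
  rcases i with i | i
  · simp only [basicWeight, if_neg (not_le.2 ham), if_neg h1, Sum.elim_inl]
    rw [zero_pow (by omega), mul_zero]
  · simp only [basicWeight, if_neg (not_le.2 ham), if_neg h1, Sum.elim_inr,
      show m₁ + m₂ - (m₁ + m₂ - 1) = 1 by omega, _root_.pow_one]
    rw [_root_.mul_pow (-s), ← mul_assoc, ← zpow_natCast (-s) (m₁ + m₂ - a), ← zpow_add₀ hs,
      show 1 - ((m₁ : ℤ) + m₂) + a + (m₁ + m₂ - a : ℕ) = 1 by omega, zpow_one]

variable [CharZero F]

theorem exists_isWaveBasis (h : IsRootData s m₁ m₂ c₁ ω₁ c₂ ω₂) :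
    ∃ ξ η, IsWaveBasis s m₁ m₂ (multiplierExp m₁ m₂) (multiplierCoeff m₁ m₂ c₁ ω₁ c₂ ω₂) ξ η := by
  have hm₁ := h.left_pos
  have hm₂ := h.right_pos
  have h1 : ∀ i : Fin m₁, ∃ ξ η, IsWavePair s m₁ m₂ (1 / m₁) (c₁ * ω₁ ^ (i : ℕ)) ξ η := fun i =>
    exists_isWavePair_left hm₁ (h.left_ne_zero i) (by
      rw [_root_.mul_pow, ← _root_.pow_mul, mul_comm (i : ℕ), _root_.pow_mul,
        h.left_root.pow_eq_one, _root_.one_pow, mul_one, h.left_pow])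
  have h2 : ∀ i : Fin m₂, ∃ ξ η, IsWavePair s m₁ m₂ (-(1 / m₂)) (c₂ * ω₂ ^ (i : ℕ))⁻¹ ξ η :=
    fun i => exists_isWavePair_right hm₂ (h.right_ne_zero i) (by
      rw [_root_.mul_pow, ← _root_.pow_mul, mul_comm (i : ℕ), _root_.pow_mul,
        h.right_root.pow_eq_one, _root_.one_pow, mul_one, h.right_pow])
  choose ξ₁ η₁ h1 using h1
  choose ξ₂ η₂ h2 using h2
  have hp₁ : (0 : ℚ) < 1 / m₁ := by positivity
  have hp₂ : (0 : ℚ) < 1 / m₂ := by positivity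
  refine ⟨Sum.elim ξ₁ ξ₂, Sum.elim η₁ η₂, h.s_ne_zero, hm₁, hm₂, ?_, ?_, ?_⟩
  · rintro (i | i)
    · exact h1 i
    · exact h2 i
  · rintro (i | i)
    · exact (h1 i).pairing_ne_zero_left hm₁ hm₂
    · exact (h2 i).pairing_ne_zero_right hm₁ hm₂
  -- Across the families the exponents have opposite signs; within a family the leading coefficients
  -- are distinct roots of the same number.
  · rintro (i | i) (j | j) hr hc
    · congr 1
      have hc0 := left_ne_zero_of_mul (h.left_ne_zero i)
      exact Fin.ext (h.left_root.pow_inj i.2 j.2 (mul_left_cancel₀ hc0 hc))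
    · simp only [multiplierExp, Sum.elim_inl, Sum.elim_inr] at hr
      linarith
    · simp only [multiplierExp, Sum.elim_inl, Sum.elim_inr] at hr
      linarith
    · congr 1
      have hc0 := left_ne_zero_of_mul (h.right_ne_zero i)
      exact Fin.ext (h.right_root.pow_inj i.2 j.2 (mul_left_cancel₀ hc0 (inv_injective hc)))

/-- In a column q < m₁ the leading term of the (p, q) entry is a sum of (a + q - p)-th powers of the
m₁ roots, which vanishes unless m₁ divides a + q - p. Columns q ≥ m₁ only decay. -/
theorem coeff_spectral_left (h : IsRootData s m₁ m₂ c₁ ω₁ c₂ ω₂)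
    {ξ η : Fin m₁ ⊕ Fin m₂ → HahnSeries ℚ F}
    (hB : IsWaveBasis s m₁ m₂ (multiplierExp m₁ m₂) (multiplierCoeff m₁ m₂ c₁ ω₁ c₂ ω₂) ξ η)
    {a : ℕ} (ha : 1 ≤ a) (ham : a ≤ m₁) (p q : Fin (m₁ + m₂)) {e : ℚ} (he : e ≤ 0) :
    (spectral m₁ m₂ ξ η (basicWeight s m₁ m₂ c₁ ω₁ c₂ ω₂ a) p q).coeff e =
      if e = (a : ℚ) / m₁ - 1 then basicLeading F m₁ a p q else 0 := by
  have hm₁ := h.left_pos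
  have hm₂ := h.right_pos
  have hp := p.2
  have hq := q.2
  have hm₁Q : (0 : ℚ) < m₁ := by exact_mod_cast hm₁
  have hm₁F : (m₁ : F) ≠ 0 := by exact_mod_cast (by omega : m₁ ≠ 0)
  rw [spectral_apply, Fintype.sum_sum_type]
  simp only [basicWeight, basicLeading, if_pos ham, Sum.elim_inl, Sum.elim_inr, map_zero, zero_mul,
    Finset.sum_const_zero, add_zero]
  by_cases hqm : (q : ℕ) < m₁
  · have hL := IsLead.sum (s := Finset.univ) fun (i : Fin m₁) _ =>
      (IsWavePair.lead_div_left_of_lt hm₁ hm₂ (hB.pair (Sum.inl i)) hp hqm).C_mul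
        (s * (c₁ * ω₁ ^ (i : ℕ)) ^ a)
    have hlt : ((q : ℕ) : ℚ) - (p : ℕ) < m₁ := by
      have : ((q : ℕ) : ℚ) < m₁ := by exact_mod_cast hqm
      have : (0 : ℚ) ≤ (p : ℕ) := by positivity
      linarith
    rw [hL.coeff_of_lt (by
      have : (((q : ℕ) : ℚ) - (p : ℕ)) / m₁ < 1 := by rwa [div_lt_one hm₁Q]
      linarith)]
    have hsum : ∑ i : Fin m₁, s * (c₁ * ω₁ ^ (i : ℕ)) ^ a * ((m₁ : F)⁻¹ *
        multiplierCoeff m₁ m₂ c₁ ω₁ c₂ ω₂ (Sum.inl i) ^ (((q : ℕ) : ℤ) - (p : ℕ))) =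
        if (m₁ : ℤ) ∣ a + ((q : ℕ) - (p : ℕ)) then
          s * c₁ ^ ((a : ℤ) + ((q : ℕ) - (p : ℕ))) else 0 := by
      have := sum_zpow_mul_rootOfUnity hm₁ (c := c₁) h.left_root (a + ((q : ℕ) - (p : ℕ)))
      rw [← mul_right_inj' hm₁F, ← mul_right_inj' (inv_ne_zero h.s_ne_zero)]
      have h2 : (s : F)⁻¹ * (m₁ * if (m₁ : ℤ) ∣ a + ((q : ℕ) - (p : ℕ)) then
          s * c₁ ^ ((a : ℤ) + ((q : ℕ) - (p : ℕ))) else 0) =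
          if (m₁ : ℤ) ∣ a + ((q : ℕ) - (p : ℕ)) then
          m₁ * c₁ ^ ((a : ℤ) + ((q : ℕ) - (p : ℕ))) else 0 := by
        have := h.s_ne_zero
        split_ifs
        · field_simp
        · ring
      rw [h2, ← this, Finset.mul_sum, Finset.mul_sum]
      refine Finset.sum_congr rfl fun i _ => ?_
      rw [zpow_add₀ (h.left_ne_zero i), zpow_natCast]
      simp only [multiplierCoeff, Sum.elim_inl]
      have := h.s_ne_zero
      generalize (c₁ * ω₁ ^ (i : ℕ)) ^ (((q : ℕ) : ℤ) - (p : ℕ)) = x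
      field_simp
    rw [hsum]
    by_cases hk : (q : ℕ) = m₁ - a + p ∧ (p : ℕ) < a
    · rw [if_pos hk]
      have hz : (a : ℤ) + ((q : ℕ) - (p : ℕ)) = m₁ := by omega
      have hzQ : -((((q : ℕ) : ℚ) - (p : ℕ)) / m₁) = a / m₁ - 1 := by
        have : (a : ℚ) + ((q : ℕ) - (p : ℕ)) = m₁ := by exact_mod_cast hz
        rw [show ((q : ℕ) : ℚ) - (p : ℕ) = m₁ - a by linarith]
        field_simp
        ring
      rw [hz, hzQ, if_pos (dvd_refl _), zpow_natCast, h.left_pow, mul_inv_cancel₀ h.s_ne_zero]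
    · rw [if_neg hk, ite_self]
      refine ite_eq_right_iff.2 fun hee => if_neg ?_
      rintro ⟨t, ht⟩
      -- The condition e ≤ 0 gives q ≥ p, so a + q - p lies strictly between 0 and 2 m₁, and m₁ is
      -- the only multiple left. That is exactly the support of the leading matrix.
      have h1 : (0 : ℤ) ≤ (q : ℕ) - (p : ℕ) := by
        have : (0 : ℚ) ≤ (((q : ℕ) : ℚ) - (p : ℕ)) / m₁ := by linarith
        rw [div_nonneg_iff] at this
        rcases this with h1 | h1
        · exact_mod_cast h1.1
        · exact absurd h1.2 (by linarith)
      have ht1 : 0 < t := by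
        by_contra hneg
        have : (m₁ : ℤ) * t ≤ 0 := mul_nonpos_of_nonneg_of_nonpos (by omega) (by omega)
        omega
      have ht2 : t < 2 := by
        by_contra hneg
        have : (m₁ : ℤ) * 2 ≤ m₁ * t := mul_le_mul_of_nonneg_left (by omega) (by omega)
        omega
      have ht3 : t = 1 := by omega
      rw [ht3, mul_one] at ht
      exact hk (by omega)
  · rw [if_neg (by omega : ¬ ((q : ℕ) = m₁ - a + p ∧ (p : ℕ) < a)), ite_self]
    refine IsBigO.sum (s := Finset.univ) (fun (i : Fin m₁) _ => (IsBigO.C _).mul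
      (IsWavePair.isBigO_div_left_of_le hm₁ hm₂ (hB.pair (Sum.inl i)) hp (not_lt.1 hqm) hq)) e ?_
    have : (0 : ℚ) < (m₁ : ℚ) + m₂ + (p : ℕ) - (q : ℕ) := by
      have : ((q : ℕ) : ℚ) < m₁ + m₂ := by exact_mod_cast hq
      have : (0 : ℚ) ≤ (p : ℕ) := by positivity
      linarith
    have : (0 : ℚ) < ((m₁ : ℚ) + m₂ + (p : ℕ) - (q : ℕ)) / m₁ := by positivity
    linarith

theorem coeff_spectral_right (h : IsRootData s m₁ m₂ c₁ ω₁ c₂ ω₂)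
    {ξ η : Fin m₁ ⊕ Fin m₂ → HahnSeries ℚ F}
    (hB : IsWaveBasis s m₁ m₂ (multiplierExp m₁ m₂) (multiplierCoeff m₁ m₂ c₁ ω₁ c₂ ω₂) ξ η)
    {a : ℕ} (ham : m₁ < a) (hal : a < m₁ + m₂) (p q : Fin (m₁ + m₂)) {e : ℚ} (he : e ≤ 0) :
    (spectral m₁ m₂ ξ η (basicWeight s m₁ m₂ c₁ ω₁ c₂ ω₂ a) p q).coeff e =
      if e = ((m₁ : ℚ) + m₂ - a) / m₂ - 1 then basicLeading F m₁ a p q else 0 := by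
  have hm₁ := h.left_pos
  have hm₂ := h.right_pos
  have hp := p.2
  have hq := q.2
  have hm₂Q : (0 : ℚ) < m₂ := by exact_mod_cast hm₂
  have hm₂F : (m₂ : F) ≠ 0 := by exact_mod_cast (by omega : m₂ ≠ 0)
  rw [spectral_apply, Fintype.sum_sum_type]
  simp only [basicWeight, basicLeading, if_neg (not_le.2 ham), Sum.elim_inl, Sum.elim_inr, map_zero,
    zero_mul, Finset.sum_const_zero, zero_add]
  by_cases hqm : m₁ ≤ (q : ℕ)
  · have hL := IsLead.sum (s := Finset.univ) fun (i : Fin m₂) _ =>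
      (IsWavePair.lead_div_right_of_le hm₁ hm₂ (hB.pair (Sum.inr i)) hp hqm hq).C_mul
        (-s * (c₂ * ω₂ ^ (i : ℕ)) ^ (m₁ + m₂ - a))
    have hlt : ((p : ℕ) : ℚ) - (q : ℕ) < m₂ := by
      have : ((p : ℕ) : ℚ) < m₁ + m₂ := by exact_mod_cast hp
      have : (m₁ : ℚ) ≤ (q : ℕ) := by exact_mod_cast hqm
      linarith
    rw [hL.coeff_of_lt (by
      have : (((p : ℕ) : ℚ) - (q : ℕ)) / m₂ < 1 := by rwa [div_lt_one hm₂Q]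
      linarith)]
    obtain ⟨b, hb⟩ : ∃ b, b = m₁ + m₂ - a := ⟨_, rfl⟩
    have hbQ : (m₁ : ℚ) + m₂ - a = b := by
      rw [hb, Nat.cast_sub (by omega), Nat.cast_add]
    rw [← hb, hbQ]
    have hsum : ∑ i : Fin m₂, -s * (c₂ * ω₂ ^ (i : ℕ)) ^ b * ((m₂ : F)⁻¹ *
        multiplierCoeff m₁ m₂ c₁ ω₁ c₂ ω₂ (Sum.inr i) ^ (((q : ℕ) : ℤ) - (p : ℕ))) =
        if (m₂ : ℤ) ∣ b + ((p : ℕ) - (q : ℕ)) then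
          -s * c₂ ^ ((b : ℤ) + ((p : ℕ) - (q : ℕ))) else 0 := by
      have := sum_zpow_mul_rootOfUnity hm₂ (c := c₂) h.right_root (b + ((p : ℕ) - (q : ℕ)))
      rw [← mul_right_inj' hm₂F, ← mul_right_inj' (inv_ne_zero h.s_ne_zero)]
      have h2 : (s : F)⁻¹ * (m₂ * if (m₂ : ℤ) ∣ b + ((p : ℕ) - (q : ℕ)) then
          -s * c₂ ^ ((b : ℤ) + ((p : ℕ) - (q : ℕ))) else 0) =
          -if (m₂ : ℤ) ∣ b + ((p : ℕ) - (q : ℕ)) then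
          m₂ * c₂ ^ ((b : ℤ) + ((p : ℕ) - (q : ℕ))) else 0 := by
        have := h.s_ne_zero
        split_ifs
        · field_simp
        · ring
      rw [h2, ← this, Finset.mul_sum, Finset.mul_sum, ← Finset.sum_neg_distrib]
      refine Finset.sum_congr rfl fun i _ => ?_
      rw [zpow_add₀ (h.right_ne_zero i), zpow_natCast]
      simp only [multiplierCoeff, Sum.elim_inr]
      rw [inv_zpow', neg_sub]
      have := h.s_ne_zero
      generalize (c₂ * ω₂ ^ (i : ℕ)) ^ (((p : ℕ) : ℤ) - (q : ℕ)) = x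
      field_simp
    rw [hsum]
    by_cases hk : m₁ ≤ (q : ℕ) ∧ (p : ℕ) = a + (q - m₁)
    · rw [if_pos hk]
      have hz : (b : ℤ) + ((p : ℕ) - (q : ℕ)) = m₂ := by omega
      have hzQ : -((((p : ℕ) : ℚ) - (q : ℕ)) / m₂) = b / m₂ - 1 := by
        have : (b : ℚ) + ((p : ℕ) - (q : ℕ)) = m₂ := by exact_mod_cast hz
        rw [show ((p : ℕ) : ℚ) - (q : ℕ) = m₂ - b by linarith]
        field_simp
        ring
      rw [hz, hzQ, if_pos (dvd_refl _), zpow_natCast, h.right_pow, neg_mul,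
        mul_inv_cancel₀ h.s_ne_zero]
    · rw [if_neg hk, ite_self]
      refine ite_eq_right_iff.2 fun hee => if_neg ?_
      rintro ⟨t, ht⟩
      have h1 : (0 : ℤ) ≤ (p : ℕ) - (q : ℕ) := by
        have : (0 : ℚ) ≤ (((p : ℕ) : ℚ) - (q : ℕ)) / m₂ := by linarith
        rw [div_nonneg_iff] at this
        rcases this with h1 | h1
        · exact_mod_cast h1.1
        · exact absurd h1.2 (by linarith)
      have ht1 : 0 < t := by
        by_contra hneg
        have : (m₂ : ℤ) * t ≤ 0 := mul_nonpos_of_nonneg_of_nonpos (by omega) (by omega)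
        omega
      have ht2 : t < 2 := by
        by_contra hneg
        have : (m₂ : ℤ) * 2 ≤ m₂ * t := mul_le_mul_of_nonneg_left (by omega) (by omega)
        omega
      have ht3 : t = 1 := by omega
      rw [ht3, mul_one] at ht
      exact hk (by omega)
  · rw [if_neg (by omega : ¬ (m₁ ≤ (q : ℕ) ∧ (p : ℕ) = a + (q - m₁))), ite_self]
    refine IsBigO.sum (s := Finset.univ) (fun (i : Fin m₂) _ => (IsBigO.C _).mul
      (IsWavePair.isBigO_div_right_of_lt hm₁ hm₂ (hB.pair (Sum.inr i)) hp (not_le.1 hqm))) e ?_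
    have : (0 : ℚ) < (m₁ : ℚ) + m₂ + (q : ℕ) - (p : ℕ) := by
      have : ((p : ℕ) : ℚ) < m₁ + m₂ := by exact_mod_cast hp
      have : (0 : ℚ) ≤ (q : ℕ) := by positivity
      linarith
    have : (0 : ℚ) < ((m₁ : ℚ) + m₂ + (q : ℕ) - (p : ℕ)) / m₂ := by positivity
    linarith

theorem coeff_spectral (h : IsRootData s m₁ m₂ c₁ ω₁ c₂ ω₂)
    {ξ η : Fin m₁ ⊕ Fin m₂ → HahnSeries ℚ F}
    (hB : IsWaveBasis s m₁ m₂ (multiplierExp m₁ m₂) (multiplierCoeff m₁ m₂ c₁ ω₁ c₂ ω₂) ξ η)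
    {a : ℕ} (ha : 1 ≤ a) (hal : a < m₁ + m₂) (p q : Fin (m₁ + m₂)) {e : ℚ} (he : e ≤ 0) :
    (spectral m₁ m₂ ξ η (basicWeight s m₁ m₂ c₁ ω₁ c₂ ω₂ a) p q).coeff e =
      if e = qDeg m₁ m₂ a - 1 then basicLeading F m₁ a p q else 0 := by
  by_cases ham : a ≤ m₁
  · rw [h.coeff_spectral_left hB ha ham p q he, qDeg, if_pos ham]
  · rw [h.coeff_spectral_right hB (not_le.1 ham) hal p q he, qDeg, if_neg ham]

end IsRootData

end WaveBasis

/-! ### Passing between ℂ(s) and an extension of it -/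

noncomputable section Descent

theorem zShift_eq_shift (f : ZSeries) : zShift f = shift CoeffField f := by
  ext e
  rw [coeff_shift]
  refine finsum_congr fun k => ?_
  rw [shiftCoeff, eq_ratCast]

theorem matW_eq_laxMatrix (m₁ m₂ : ℕ) : matW m₁ m₂ = laxMatrix sVar m₁ m₂ := rfl

theorem satisfiesTDE_iff {m₁ m₂ : ℕ} {M : Matrix (Fin (m₁ + m₂)) (Fin (m₁ + m₂)) ZSeries} :
    SatisfiesTDE m₁ m₂ M ↔ IsEquivariant sVar M := by
  rw [SatisfiesTDE, IsEquivariant, matW_eq_laxMatrix, show zShift = shift CoeffField from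
    funext zShift_eq_shift]

theorem matK_apply {m₁ m₂ a : ℕ} (hal : a < m₁ + m₂) (p q : Fin (m₁ + m₂)) :
    matK m₁ m₂ a p q = basicLeading CoeffField m₁ a p q := by
  have hp := p.2
  have hq := q.2
  rw [matK, basicLeading]
  split_ifs with ham hk hk
  · rw [Matrix.sum_apply, Finset.sum_eq_single (p + 1 : ℕ)]
    · exact if_pos ⟨rfl, by omega⟩
    · intro j _ hj
      exact if_neg fun h => hj h.1.symm
    · intro hn
      simp at hn
      omega
  · rw [Matrix.sum_apply]
    refine Finset.sum_eq_zero fun j hj => if_neg fun h => hk ?_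
    simp at hj
    omega
  · rw [Matrix.neg_apply, Matrix.sum_apply, Finset.sum_eq_single (q + 1 - m₁ : ℕ)]
    · exact congrArg _ (if_pos ⟨by omega, by omega⟩)
    · intro j _ hj
      exact if_neg fun h => hj (by omega)
    · intro hn
      simp at hn
      omega
  · rw [Matrix.neg_apply, Matrix.sum_apply, neg_eq_zero]
    refine Finset.sum_eq_zero fun j hj => if_neg fun h => hk ?_
    simp at hj
    omega

theorem coeff_ofLaurent_intCast (g : LaurentSeries CoeffField) (n : ℤ) :
    (ofLaurent g).coeff (n : ℚ) = g.coeff n :=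
  embDomain_coeff (f := ⟨⟨Int.castAddHom ℚ, Int.cast_injective⟩, Int.cast_le⟩)

theorem coeff_ofLaurent_of_forall_ne (g : LaurentSeries CoeffField) {e : ℚ}
    (he : ∀ n : ℤ, e ≠ n) : (ofLaurent g).coeff e = 0 := by
  refine embDomain_of_notMem_range ?_
  rintro ⟨n, hn⟩
  exact he n hn.symm

theorem coeff_zPow_mul (r : ℚ) (f : ZSeries) (e : ℚ) : (zPow r * f).coeff e = f.coeff (e + r) := by
  rw [zPow, coeff_single_mul, one_mul, sub_neg_eq_add]

theorem HasLeadingForm.coeff {m₁ m₂ a : ℕ} {M : Matrix (Fin (m₁ + m₂)) (Fin (m₁ + m₂)) ZSeries}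
    (h : HasLeadingForm m₁ m₂ a M) (p q : Fin (m₁ + m₂)) {e : ℚ} (he : e < qDeg m₁ m₂ a) :
    (M p q).coeff e = if e = qDeg m₁ m₂ a - 1 then matK m₁ m₂ a p q else 0 := by
  obtain ⟨N, rfl, hN⟩ := h
  rw [Matrix.smul_apply, Matrix.map_apply, smul_eq_mul, coeff_zPow_mul]
  by_cases hn : ∃ n : ℤ, e + (1 - qDeg m₁ m₂ a) = n
  · obtain ⟨n, hn⟩ := hn
    have hn1 : n < 1 := by
      have : (n : ℚ) < 1 := by linarith
      exact_mod_cast this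
    have := hN p q n hn1
    rw [coeff_sub, sub_eq_zero, C_apply, coeff_single] at this
    rw [hn, coeff_ofLaurent_intCast, this]
    have : n = 0 ↔ e = qDeg m₁ m₂ a - 1 := by
      rw [← Int.cast_eq_zero (α := ℚ), ← hn]
      constructor <;> intro <;> linarith
    simp only [this]
  · rw [coeff_ofLaurent_of_forall_ne _ fun n h => hn ⟨n, h⟩, if_neg]
    intro h
    exact hn ⟨0, by rw [h]; simp⟩

theorem hasLeadingForm_of_coeff {m₁ m₂ a : ℕ}
    {M : Matrix (Fin (m₁ + m₂)) (Fin (m₁ + m₂)) ZSeries}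
    (h : ∀ p q e, e < qDeg m₁ m₂ a →
      (M p q).coeff e = if e = qDeg m₁ m₂ a - 1 then matK m₁ m₂ a p q else 0)
    (hM : ∀ p q e, (∀ n : ℤ, e + (1 - qDeg m₁ m₂ a) ≠ n) → (M p q).coeff e = 0) :
    HasLeadingForm m₁ m₂ a M := by
  have hneg : ∀ p q, ∀ n : ℤ, n < 1 → (M p q).coeff (n - (1 - qDeg m₁ m₂ a)) =
      if n = 0 then matK m₁ m₂ a p q else 0 := by
    intro p q n hn
    have hn' : (n : ℚ) < 1 := by exact_mod_cast hn
    rw [h p q _ (by linarith)]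
    have : (n : ℚ) - (1 - qDeg m₁ m₂ a) = qDeg m₁ m₂ a - 1 ↔ n = 0 := by
      rw [← Int.cast_eq_zero (α := ℚ)]
      constructor <;> intro <;> linarith
    simp only [this]
  refine ⟨Matrix.of fun p q => ofSuppBddBelow (fun n : ℤ =>
    (M p q).coeff (n - (1 - qDeg m₁ m₂ a))) ⟨0, fun n hn => ?_⟩, ?_, ?_⟩
  · by_contra hlt
    refine hn ?_
    simp only
    rw [hneg p q n (by omega), if_neg (by omega)]
  · ext1 p q
    ext e
    rw [Matrix.smul_apply, Matrix.map_apply, smul_eq_mul, coeff_zPow_mul, Matrix.of_apply]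
    by_cases hn : ∃ n : ℤ, e + (1 - qDeg m₁ m₂ a) = n
    · obtain ⟨n, hn⟩ := hn
      rw [hn, coeff_ofLaurent_intCast]
      change _ = (M p q).coeff (n - (1 - qDeg m₁ m₂ a))
      rw [← hn, add_sub_cancel_right]
    · have hn' : ∀ n : ℤ, e + (1 - qDeg m₁ m₂ a) ≠ n := fun n h => hn ⟨n, h⟩
      rw [coeff_ofLaurent_of_forall_ne _ hn', hM p q e hn']
  · intro p q n hn
    rw [coeff_sub, sub_eq_zero, C_apply, coeff_single]
    refine (hneg p q n hn).trans ?_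
    congr

variable {k F : Type} [Field k] [Field F] [Algebra k F]

/-- Extension of the field of coefficients. -/
def extendCoeff (k F : Type) [Field k] [Field F] [Algebra k F] :
    HahnSeries ℚ k →+* HahnSeries ℚ F where
  toFun f := f.map (algebraMap k F)
  map_one' := HahnSeries.map_one (algebraMap k F).toMonoidWithZeroHom
  map_mul' _ _ := HahnSeries.map_mul (algebraMap k F).toNonUnitalRingHom
  map_zero' := HahnSeries.map_zero (algebraMap k F).toAddMonoidHom.toZeroHom
  map_add' _ _ := HahnSeries.map_add (algebraMap k F).toAddMonoidHom

theorem coeff_extendCoeff (f : HahnSeries ℚ k) (e : ℚ) :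
    (extendCoeff k F f).coeff e = algebraMap k F (f.coeff e) := rfl

theorem extendCoeff_C (x : k) : extendCoeff k F (C x) = C (algebraMap k F x) :=
  map_C x (algebraMap k F)

theorem extendCoeff_single (e : ℚ) (x : k) :
    extendCoeff k F (single e x) = single e (algebraMap k F x) :=
  HahnSeries.map_single (algebraMap k F).toAddMonoidHom.toZeroHom

theorem extendCoeff_zVar : extendCoeff k F (zVar k) = zVar F :=
  extendCoeff_single _ _ |>.trans (by rw [map_one]; rfl)

theorem extendCoeff_matUnit (l i j : ℕ) :
    (matUnit (HahnSeries ℚ k) l i j).map (extendCoeff k F) = matUnit (HahnSeries ℚ F) l i j := by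
  ext1 p q
  rw [Matrix.map_apply, matUnit, matUnit, Matrix.of_apply, Matrix.of_apply]
  split_ifs <;> simp

theorem extendCoeff_laxMatrix (s : k) (m₁ m₂ : ℕ) :
    (laxMatrix s m₁ m₂).map (extendCoeff k F) = laxMatrix (algebraMap k F s) m₁ m₂ := by
  have h : ∀ i j, ∀ p q : Fin (m₁ + m₂),
      extendCoeff k F (matUnit (HahnSeries ℚ k) (m₁ + m₂) i j p q) =
        matUnit (HahnSeries ℚ F) (m₁ + m₂) i j p q := fun i j p q =>
    congrFun (congrFun (extendCoeff_matUnit (m₁ + m₂) i j) p) q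
  ext1 p q
  simp only [laxMatrix, Matrix.map_apply, Matrix.add_apply, Matrix.sub_apply, Matrix.smul_apply,
    smul_eq_mul, Matrix.sum_apply, map_add, map_sub, map_mul, map_sum, h, extendCoeff_C,
    extendCoeff_zVar, map_div₀, map_one, map_ofNat]

/-- Applying a linear functional to the coefficients and keeping only the exponents in the class
of `r` modulo `ℤ`. -/
def restrictCoeff (ρ : F →ₗ[k] k) (r : ℚ) : HahnSeries ℚ F →+ HahnSeries ℚ k where
  toFun f :=
    { coeff := fun e => open Classical in if ∃ n : ℤ, e + r = n then ρ (f.coeff e) else 0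
      isPWO_support' := f.isPWO_support.mono fun e he h => he (by simp [h]) }
  map_zero' := by
    ext e
    simp
  map_add' f g := by
    ext e
    simp only [coeff_add]
    split_ifs <;> simp

theorem coeff_restrictCoeff_of_eq (ρ : F →ₗ[k] k) {r e : ℚ} (f : HahnSeries ℚ F) {n : ℤ}
    (h : e + r = n) : (restrictCoeff ρ r f).coeff e = ρ (f.coeff e) :=
  if_pos ⟨n, h⟩

theorem coeff_restrictCoeff_of_ne (ρ : F →ₗ[k] k) {r e : ℚ} (f : HahnSeries ℚ F)
    (h : ∀ n : ℤ, e + r ≠ n) : (restrictCoeff ρ r f).coeff e = 0 :=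
  if_neg fun ⟨n, hn⟩ => h n hn

theorem coeff_restrictCoeff_sub_intCast (ρ : F →ₗ[k] k) (r e : ℚ) (f : HahnSeries ℚ F) (n : ℤ)
    (x : k) :
    x * (restrictCoeff ρ r f).coeff (e - n) = open Classical in
      if ∃ n : ℤ, e + r = n then ρ (algebraMap k F x * f.coeff (e - n)) else 0 := by
  split_ifs with h
  · obtain ⟨t, ht⟩ := h
    rw [coeff_restrictCoeff_of_eq ρ f (n := t - n) (by push_cast; linarith), ← Algebra.smul_def,
      map_smul, smul_eq_mul]
  · rw [coeff_restrictCoeff_of_ne ρ f, mul_zero]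
    intro t ht
    exact h ⟨t + n, by push_cast; linarith⟩

/-- The series by which `restrictCoeff` is linear. -/
def restrictScalarsSubring (ρ : F →ₗ[k] k) (r : ℚ) : Subring (HahnSeries ℚ k) where
  carrier := {g | ∀ f, restrictCoeff ρ r (extendCoeff k F g * f) = g * restrictCoeff ρ r f}
  mul_mem' {g g'} hg hg' f := by rw [map_mul (extendCoeff k F), mul_assoc, hg, hg', mul_assoc]
  one_mem' f := by rw [map_one, one_mul, one_mul]
  add_mem' {g g'} hg hg' f := by rw [map_add, add_mul, map_add, hg, hg', add_mul]
  zero_mem' f := by rw [map_zero, zero_mul, zero_mul, map_zero]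
  neg_mem' {g} hg f := by rw [map_neg, neg_mul, map_neg, hg, neg_mul]

/-- An integral exponent preserves classes modulo ℤ, and a coefficient from k passes through the
k-linear map ρ. -/
theorem single_mem_restrictScalarsSubring (ρ : F →ₗ[k] k) (r : ℚ) (n : ℤ) (x : k) :
    single (n : ℚ) x ∈ restrictScalarsSubring ρ r := by
  intro f
  ext e
  rw [extendCoeff_single, coeff_single_mul, coeff_restrictCoeff_sub_intCast]
  split_ifs with h
  · obtain ⟨t, ht⟩ := h
    rw [coeff_restrictCoeff_of_eq ρ _ ht, coeff_single_mul]
  · exact coeff_restrictCoeff_of_ne ρ _ fun t ht => h ⟨t, ht⟩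

theorem laxMatrix_mem_restrictScalarsSubring (ρ : F →ₗ[k] k) (r : ℚ) (s : k) {m₁ m₂ : ℕ}
    (p q : Fin (m₁ + m₂)) : laxMatrix s m₁ m₂ p q ∈ restrictScalarsSubring ρ r := by
  have hC : ∀ x : k, C x ∈ restrictScalarsSubring ρ r := fun x => by
    simpa using single_mem_restrictScalarsSubring ρ r 0 x
  have hz : zVar k ∈ restrictScalarsSubring ρ r := by
    simpa [zVar] using single_mem_restrictScalarsSubring ρ r (-1) 1
  have hU : ∀ i j, matUnit (HahnSeries ℚ k) (m₁ + m₂) i j p q ∈ restrictScalarsSubring ρ r :=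
    fun i j => by
      rw [matUnit, Matrix.of_apply]
      split_ifs
      · exact one_mem _
      · exact zero_mem _
  rw [laxMatrix, Matrix.add_apply, Matrix.sub_apply, Matrix.smul_apply, Matrix.smul_apply,
    Matrix.smul_apply, Matrix.sum_apply]
  exact add_mem (sub_mem (mul_mem (sub_mem hz (hC _)) (hU _ _)) (mul_mem (hC _) (hU _ _)))
    (mul_mem (hC _) (sum_mem fun i _ => hU _ _))

variable [CharZero k] [CharZero F]

theorem algebraMap_shiftCoeff (n : ℕ) (r : ℚ) :
    algebraMap k F (shiftCoeff k n r) = shiftCoeff F n r := by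
  simp [shiftCoeff]

theorem extendCoeff_shift (f : HahnSeries ℚ k) :
    extendCoeff k F (shift k f) = shift F (extendCoeff k F f) := by
  ext e
  rw [coeff_extendCoeff, coeff_shift, coeff_shift]
  refine (AddMonoidHom.map_finsum_of_injective (algebraMap k F).toAddMonoidHom
    (algebraMap k F).injective _).trans ?_
  refine finsum_congr fun n => ?_
  rw [coeff_extendCoeff, ← algebraMap_shiftCoeff (k := k) (F := F)]
  exact map_mul (algebraMap k F) _ _

/-- The shift moves exponents by integers and has rational coefficients, so it respects both the
class of r and the linear map ρ. -/
theorem restrictCoeff_shift (ρ : F →ₗ[k] k) (r : ℚ) (f : HahnSeries ℚ F) :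
    restrictCoeff ρ r (shift F f) = shift k (restrictCoeff ρ r f) := by
  ext e
  have h1 : ∀ n : ℕ, shiftCoeff k n (n - e) * (restrictCoeff ρ r f).coeff (e - n) =
      open Classical in
      if ∃ n : ℤ, e + r = n then ρ (shiftCoeff F n (n - e) * f.coeff (e - n)) else 0 := fun n => by
    have := coeff_restrictCoeff_sub_intCast ρ r e f n (shiftCoeff k n (n - e))
    rwa [algebraMap_shiftCoeff, Int.cast_natCast] at this
  rw [coeff_shift, finsum_congr h1]
  by_cases h : ∃ n : ℤ, e + r = n
  · obtain ⟨t, ht⟩ := id h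
    simp only [if_pos h]
    rw [coeff_restrictCoeff_of_eq ρ _ ht, coeff_shift]
    refine AddMonoidHom.map_finsum ρ.toAddMonoidHom ?_
    refine ((shiftFamily f).finite_co_support e).subset fun n hn => ?_
    simp only [Function.mem_support, coeff_shiftFamily] at hn ⊢
    exact hn
  · simp only [if_neg h, finsum_zero]
    exact coeff_restrictCoeff_of_ne ρ _ fun t ht => h ⟨t, ht⟩

theorem IsEquivariant.extendCoeff {m₁ m₂ : ℕ} {s : k}
    {X : Matrix (Fin (m₁ + m₂)) (Fin (m₁ + m₂)) (HahnSeries ℚ k)} (hX : IsEquivariant s X) :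
    IsEquivariant (algebraMap k F s) (X.map (extendCoeff k F)) := by
  have := congrArg (fun Y : Matrix _ _ _ => Y.map (_root_.extendCoeff k F)) hX
  simp only [Matrix.map_mul, extendCoeff_laxMatrix] at this
  rw [IsEquivariant, ← this]
  congr 1
  ext1 p q
  exact (extendCoeff_shift _).symm

theorem IsEquivariant.restrictCoeff {m₁ m₂ : ℕ} {s : k} (ρ : F →ₗ[k] k) (r : ℚ)
    {X : Matrix (Fin (m₁ + m₂)) (Fin (m₁ + m₂)) (HahnSeries ℚ F)}
    (hX : IsEquivariant (algebraMap k F s) X) :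
    IsEquivariant s (X.map (restrictCoeff ρ r)) := by
  ext1 p q
  have h := congrArg (_root_.restrictCoeff ρ r) (congrFun (congrFun hX p) q)
  have hW : ∀ i j, laxMatrix (algebraMap k F s) m₁ m₂ i j =
      _root_.extendCoeff k F (laxMatrix s m₁ m₂ i j) := fun i j => by
    rw [← extendCoeff_laxMatrix, Matrix.map_apply]
  rw [Matrix.mul_apply, Matrix.mul_apply, map_sum, map_sum] at h
  rw [Matrix.mul_apply, Matrix.mul_apply]
  refine (Finset.sum_congr rfl fun j _ => ?_).trans (h.trans (Finset.sum_congr rfl fun j _ => ?_))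
  · rw [hW, mul_comm (X.map (shift F) p j), laxMatrix_mem_restrictScalarsSubring ρ r s j q,
      Matrix.map_apply, Matrix.map_apply, Matrix.map_apply, restrictCoeff_shift, mul_comm]
  · rw [hW, laxMatrix_mem_restrictScalarsSubring ρ r s p j, Matrix.map_apply]

end Descent

/-! ### Existence and uniqueness of the basic solutions over ℂ(s) -/

noncomputable section BasicSolutions

theorem IsAlgClosed.exists_isRootData {F : Type} [Field F] [CharZero F] [IsAlgClosed F] {s : F}
    (hs : s ≠ 0) {m₁ m₂ : ℕ} (hm₁ : 1 ≤ m₁) (hm₂ : 1 ≤ m₂) :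
    ∃ c₁ ω₁ c₂ ω₂, IsRootData s m₁ m₂ c₁ ω₁ c₂ ω₂ := by
  have : NeZero (m₁ : F) := ⟨by exact_mod_cast (by omega : m₁ ≠ 0)⟩
  have : NeZero (m₂ : F) := ⟨by exact_mod_cast (by omega : m₂ ≠ 0)⟩
  obtain ⟨c₁, h₁⟩ := IsAlgClosed.exists_pow_nat_eq s⁻¹ hm₁
  obtain ⟨c₂, h₂⟩ := IsAlgClosed.exists_pow_nat_eq s⁻¹ hm₂
  obtain ⟨ω₁, hω₁⟩ := HasEnoughRootsOfUnity.exists_primitiveRoot F m₁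
  obtain ⟨ω₂, hω₂⟩ := HasEnoughRootsOfUnity.exists_primitiveRoot F m₂
  exact ⟨c₁, ω₁, c₂, ω₂, hs, hm₁, hm₂, h₁, h₂, hω₁, hω₂⟩

/-- There are finitely many entries, so their positive orders have a common positive lower bound. -/
theorem IsWaveBasis.eq_zero_of_coeff {F : Type} [Field F] [CharZero F] {m₁ m₂ : ℕ} {s : F}
    {r : Fin m₁ ⊕ Fin m₂ → ℚ} {c : Fin m₁ ⊕ Fin m₂ → F} {ξ η : Fin m₁ ⊕ Fin m₂ → HahnSeries ℚ F}
    (h : IsWaveBasis s m₁ m₂ r c ξ η)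
    {X : Matrix (Fin (m₁ + m₂)) (Fin (m₁ + m₂)) (HahnSeries ℚ F)} (hX : IsEquivariant s X)
    (h0 : ∀ p q e, e ≤ 0 → (X p q).coeff e = 0) : X = 0 := by
  have hpos : ∀ i : Fin (m₁ + m₂) × Fin (m₁ + m₂), ∃ δ : ℚ, 0 < δ ∧ IsBigO δ (X i.1 i.2) := by
    intro i
    by_cases hi : X i.1 i.2 = 0
    · exact ⟨1, one_pos, hi ▸ IsBigO.zero⟩
    · refine ⟨_, ?_, IsBigO.order _⟩
      by_contra hle
      exact mt coeff_order_eq_zero.1 hi (h0 _ _ _ (not_lt.1 hle))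
  choose δ hδ hO using hpos
  have : Nonempty (Fin (m₁ + m₂)) := ⟨⟨0, by have := h.left_pos; omega⟩⟩
  obtain ⟨i, hi⟩ := Finite.exists_min δ
  exact h.eq_zero_of_isBigO hX (hδ i) fun p q => (hO (p, q)).mono (hi _)

theorem qDeg_pos {m₁ m₂ a : ℕ} (hm₁ : 1 ≤ m₁) (hm₂ : 1 ≤ m₂) (ha : 1 ≤ a) (hal : a < m₁ + m₂) :
    0 < qDeg m₁ m₂ a := by
  have : (0 : ℚ) < m₁ := by exact_mod_cast hm₁
  have : (0 : ℚ) < m₂ := by exact_mod_cast hm₂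
  have : (0 : ℚ) < a := by exact_mod_cast ha
  have : (a : ℚ) < m₁ + m₂ := by exact_mod_cast hal
  rw [qDeg]
  split_ifs
  · positivity
  · exact div_pos (by linarith) (by positivity)

theorem qDeg_le_one {m₁ m₂ a : ℕ} (hm₁ : 1 ≤ m₁) (hm₂ : 1 ≤ m₂) : qDeg m₁ m₂ a ≤ 1 := by
  have h1 : (0 : ℚ) < m₁ := by exact_mod_cast hm₁
  have h2 : (0 : ℚ) < m₂ := by exact_mod_cast hm₂
  rw [qDeg]
  split_ifs with h
  · rw [div_le_one h1]
    exact_mod_cast h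
  · rw [div_le_one h2]
    have : (m₁ : ℚ) ≤ a := by exact_mod_cast (not_le.1 h).le
    linarith

theorem algebraMap_basicLeading {k F : Type} [Field k] [Field F] [Algebra k F] (m₁ a p q : ℕ) :
    algebraMap k F (basicLeading k m₁ a p q) = basicLeading F m₁ a p q := by
  rw [basicLeading, basicLeading]
  split_ifs <;> simp

theorem extendCoeff_injective {k F : Type} [Field k] [Field F] [Algebra k F] :
    Function.Injective (extendCoeff k F) := (extendCoeff k F).injective

theorem map_extendCoeff_constSeries_smul {F : Type} [Field F] [Algebra CoeffField F] {l : ℕ}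
    (x : CoeffField)
    (M : Matrix (Fin l) (Fin l) ZSeries) :
    (constSeries x • M).map (extendCoeff CoeffField F) =
      (C (algebraMap CoeffField F x) : HahnSeries ℚ F) • M.map (extendCoeff CoeffField F) := by
  ext1 p q
  rw [Matrix.map_apply, Matrix.smul_apply, Matrix.smul_apply, Matrix.map_apply, smul_eq_mul,
    smul_eq_mul, map_mul (extendCoeff CoeffField F)]
  congr 1
  exact extendCoeff_C x

variable {F : Type} [Field F] [CharZero F] [Algebra CoeffField F] {m₁ m₂ : ℕ}
  {c₁ ω₁ c₂ ω₂ : F} {ξ η : Fin m₁ ⊕ Fin m₂ → HahnSeries ℚ F}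

/-- Because q_a > 0, the leading form fixes all coefficients at exponents e ≤ 0. Hence the
difference of the two sides decays and is zero. -/
theorem IsTDESolution.extendCoeff_eq
    (h : IsRootData (algebraMap CoeffField F sVar) m₁ m₂ c₁ ω₁ c₂ ω₂)
    (hB : IsWaveBasis (algebraMap CoeffField F sVar) m₁ m₂ (multiplierExp m₁ m₂)
      (multiplierCoeff m₁ m₂ c₁ ω₁ c₂ ω₂) ξ η)
    {a : ℕ} (ha : 1 ≤ a) (hal : a < m₁ + m₂)
    {M : Matrix (Fin (m₁ + m₂)) (Fin (m₁ + m₂)) ZSeries} (hM : IsTDESolution m₁ m₂ a M) :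
    M.map (extendCoeff CoeffField F) = spectral m₁ m₂ ξ η
      (basicWeight (algebraMap CoeffField F sVar) m₁ m₂ c₁ ω₁ c₂ ω₂ a) := by
  rw [← sub_eq_zero]
  refine hB.eq_zero_of_coeff ((satisfiesTDE_iff.1 hM.1).extendCoeff.sub
    (hB.isEquivariant_spectral _)) fun p q e he => ?_
  have hpos := qDeg_pos h.left_pos h.right_pos ha hal
  rw [Matrix.sub_apply, coeff_sub, h.coeff_spectral hB ha hal p q he, Matrix.map_apply,
    coeff_extendCoeff, hM.2.coeff p q (by linarith), matK_apply hal,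
    ← algebraMap_basicLeading (k := CoeffField) (F := F)]
  split_ifs <;> simp

theorem exists_isTDESolution
    (h : IsRootData (algebraMap CoeffField F sVar) m₁ m₂ c₁ ω₁ c₂ ω₂)
    (hB : IsWaveBasis (algebraMap CoeffField F sVar) m₁ m₂ (multiplierExp m₁ m₂)
      (multiplierCoeff m₁ m₂ c₁ ω₁ c₂ ω₂) ξ η)
    {a : ℕ} (ha : 1 ≤ a) (hal : a < m₁ + m₂) : ∃ M, IsTDESolution m₁ m₂ a M := by
  -- A ℂ(s)-linear retraction of F onto ℂ(s), available since these are vector spaces over a field.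
  obtain ⟨ρ, hρ⟩ := (Algebra.linearMap CoeffField F).exists_leftInverse_of_injective
    (LinearMap.ker_eq_bot.2 (algebraMap CoeffField F).injective)
  have hρ' : ∀ x : CoeffField, ρ (algebraMap CoeffField F x) = x := fun x =>
    LinearMap.congr_fun hρ x
  have hle := qDeg_le_one (a := a) h.left_pos h.right_pos
  refine ⟨(spectral m₁ m₂ ξ η (basicWeight (algebraMap CoeffField F sVar) m₁ m₂ c₁ ω₁ c₂ ω₂ a)).map
    (restrictCoeff ρ (1 - qDeg m₁ m₂ a)),
    satisfiesTDE_iff.2 ((hB.isEquivariant_spectral _).restrictCoeff ρ _),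
    hasLeadingForm_of_coeff (fun p q e he => ?_) fun p q e he => coeff_restrictCoeff_of_ne ρ _ he⟩
  rw [Matrix.map_apply]
  by_cases hn : ∃ n : ℤ, e + (1 - qDeg m₁ m₂ a) = n
  · obtain ⟨n, hn⟩ := hn
    -- The coefficients of the spectral solution are known only for e ≤ 0, while the leading form
    -- concerns all e < q_a. In the retained class of exponents, e < q_a already means e ≤ q_a - 1 ≤
    -- 0.
    have hn0 : n ≤ 0 := by
      have : (n : ℚ) < 1 := by linarith
      have : n < 1 := by exact_mod_cast this
      omega
    have hn0' : (n : ℚ) ≤ 0 := by exact_mod_cast hn0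
    rw [coeff_restrictCoeff_of_eq ρ _ hn, h.coeff_spectral hB ha hal p q (by linarith),
      matK_apply hal, ← algebraMap_basicLeading (k := CoeffField) (F := F)]
    split_ifs
    · exact hρ' _
    · exact map_zero ρ
  · rw [coeff_restrictCoeff_of_ne ρ _ fun n h => hn ⟨n, h⟩, if_neg]
    intro he'
    exact hn ⟨0, by rw [he']; simp⟩

theorem map_extendCoeff_injective {k F : Type} [Field k] [Field F] [Algebra k F] {l : ℕ} :
    Function.Injective fun M : Matrix (Fin l) (Fin l) (HahnSeries ℚ k) =>
      M.map (extendCoeff k F) :=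
  Matrix.map_injective extendCoeff_injective

end BasicSolutions

theorem mainTheorem5 (m₁ m₂ : ℕ) (hm₁ : 1 ≤ m₁) (hm₂ : 1 ≤ m₂) :
    (∀ a : ℕ, 1 ≤ a → a < m₁ + m₂ →
      ∃! M : Matrix (Fin (m₁ + m₂)) (Fin (m₁ + m₂)) ZSeries, IsTDESolution m₁ m₂ a M) ∧
    ∀ M : ℕ → Matrix (Fin (m₁ + m₂)) (Fin (m₁ + m₂)) ZSeries,
      (∀ a : ℕ, 1 ≤ a → a < m₁ + m₂ → IsTDESolution m₁ m₂ a (M a)) →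
      (∀ a : ℕ, 1 ≤ a → a < m₁ + m₂ →
        (M a).trace = (if a = m₁ then (m₁ : ZSeries) else 0) ∧ (M a).det = 0) ∧
      (∀ a : ℕ, 1 ≤ a → a ≤ m₁ →
        M a = constSeries (sVar ^ (1 - (a : ℤ))) • M 1 ^ a) ∧
      (∀ a : ℕ, m₁ < a → a < m₁ + m₂ →
        M a = constSeries ((-sVar) ^ (1 - ((m₁ : ℤ) + m₂) + a)) •
          M (m₁ + m₂ - 1) ^ (m₁ + m₂ - a)) ∧
      (∀ a b : ℕ, 1 ≤ a → a ≤ m₁ → m₁ < b → b < m₁ + m₂ →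
        M a * M b = 0 ∧ M b * M a = 0) := by
  -- The closure provides the m₁-th and m₂-th roots of 1/s in the leading terms of the wave
  -- functions.
  let F := AlgebraicClosure CoeffField
  have : CharZero F := charZero_of_injective_algebraMap (algebraMap CoeffField F).injective
  have hs : algebraMap CoeffField F sVar ≠ 0 := (map_ne_zero _).2 RatFunc.X_ne_zero
  obtain ⟨c₁, ω₁, c₂, ω₂, h⟩ := IsAlgClosed.exists_isRootData hs hm₁ hm₂
  obtain ⟨ξ, η, hB⟩ := h.exists_isWaveBasis
  set E := extendCoeff CoeffField F
  have hinj : Function.Injective fun M : Matrix (Fin (m₁ + m₂)) (Fin (m₁ + m₂)) ZSeries =>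
      M.map E := map_extendCoeff_injective
  refine ⟨fun a ha hal => ?_, fun M hM => ?_⟩
  · obtain ⟨M, hM⟩ := exists_isTDESolution h hB ha hal
    refine ⟨M, hM, fun M' hM' => hinj ?_⟩
    simp only [E]
    rw [hM.extendCoeff_eq h hB ha hal, hM'.extendCoeff_eq h hB ha hal]
  · have hME := fun a ha hal => (hM a ha hal).extendCoeff_eq h hB ha hal
    refine ⟨fun a ha hal => ⟨?_, ?_⟩, fun a ha ham => hinj ?_, fun a ham hal => hinj ?_,
      fun a b ha ham hbm hbl => ⟨hinj ?_, hinj ?_⟩⟩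
    · refine extendCoeff_injective (F := F) ?_
      have h1 : extendCoeff CoeffField F (M a).trace =
          ((M a).map (extendCoeff CoeffField F)).trace := by
        simp [Matrix.trace]
      rw [h1, hME a ha hal, hB.trace_spectral, h.sum_basicWeight ha hal]
      split_ifs
      · rw [map_natCast, map_natCast]
      · rw [map_zero, map_zero]
    · refine extendCoeff_injective (F := F) ?_
      obtain ⟨i, hi⟩ := exists_basicWeight_eq_zero hm₁ hm₂ (algebraMap CoeffField F sVar)
        c₁ ω₁ c₂ ω₂ a
      rw [RingHom.map_det, RingHom.mapMatrix_apply, hME a ha hal, hB.det_spectral hi, map_zero]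
    · simp only [E]
      rw [map_extendCoeff_constSeries_smul, Matrix.map_pow, hME a ha (by omega),
        hME 1 le_rfl (by omega), hB.spectral_pow, ← spectral_smul, map_zpow₀]
      congr 1
      exact funext (h.basicWeight_eq_left ha ham)
    · simp only [E]
      rw [map_extendCoeff_constSeries_smul, Matrix.map_pow, hME a (by omega) hal,
        hME (m₁ + m₂ - 1) (by omega) (by omega), hB.spectral_pow, ← spectral_smul, map_zpow₀,
        map_neg]
      congr 1
      exact funext (h.basicWeight_eq_right ham hal)
    · simp only [E]
      rw [Matrix.map_mul, hME a ha (by omega), hME b (by omega) hbl, hB.spectral_mul,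
        Matrix.map_zero _ (map_zero _), ← spectral_zero ξ η]
      congr 1
      exact funext (basicWeight_mul_basicWeight _ _ _ _ _ ham hbm)
    · simp only [E]
      rw [Matrix.map_mul, hME a ha (by omega), hME b (by omega) hbl, hB.spectral_mul,
        Matrix.map_zero _ (map_zero _), ← spectral_zero ξ η]
      congr 1
      funext i
      rw [mul_comm, basicWeight_mul_basicWeight _ _ _ _ _ ham hbm]
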